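/- Let $\mathcal D$ be the family of dyadic subintervals of $[0,1)$. For $I\in\mathcal D$ let $\langle f\rangle_I=\frac1{|I|}\int_I f\,dx$ and let $h_I=|I|^{-1/2}(\chi_{I_+}-\chi_{I_-})$ be the Haar function ($I_-$, $I_+$ are the left and right halves of $I$). A weight is an integrable, strictly positive function $w$ on $[0,1)$; put $[w]_{A_2^d}=\sup_{I\in\mathcal D}\langle w\rangle_I\langle w^{-1}\rangle_I$, and write $w\in A_2^d$ if this is finite. Let $$M^df(x)=\sup_{I\in\mathcal D,\,I\ni x}\langle|f|\rangle_I,\qquad Sf(x)=\Big(\sum_{I\in\mathcal D}(f,h_I)^2\frac{\chi_I(x)}{|I|}\Big)^{1/2},\qquad S_wf=S(wf),$$ where $(f,h_I)=\int f h_I\,dx$. $L^2(w)$ is the space $L^2([0,1),w\,dx)$; $\|M^d\|_{w}$ and $\|S\|_w$ denote the operator norms on $L^2(w)$, and $\|f\|_{L^{2,1}(w)}=\int_0^\infty \big(w\{x\in[0,1):|f(x)|>t\}\big)^{1/2}dt$, where $w(E)=\int_E w\,dx$. **Theorem.** There are absolute constants $0<c\le C<\infty$ and a sequence of weights $w\in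 A_2^d$ with $[w]_{A_2^d}\to\infty$ such that every weight $w$ of the sequence satisfies all of the following: (1) $c\,\|M^d\|_{w^{-1}}^2\le [w]_{A_2^d}\le C\,\|M^d\|_{w^{-1}}^2$; (2) $\|S_w:L^2(w)\to L^2(w^{-1})\|=\|S\|_{w^{-1}}\ge c\,\|M^d\|_{w^{-1}}\sqrt{\log\|M^d\|_{w^{-1}}}$; (3) $\|S_w:L^{2,1}(w)\to L^2(w^{-1})\|\ge c\,\|M^d\|_{w^{-1}}\sqrt{\log\|M^d\|_{w^{-1}}}$; (4) $\|S:L^2(w)\to L^2(w)\|\ge c\,\|M^d\|_{w}\sqrt{\log\|M^d\|_{w}}$. -/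

import Mathlib

open MeasureTheory Set Filter Topology
open scoped ENNReal NNReal

noncomputable section

namespace DyadicWeights

/-- Indices of the dyadic subintervals of `[0,1)`: the pair `(n, k)` with `k < 2 ^ n` stands for
the interval `[k / 2 ^ n, (k + 1) / 2 ^ n)`. -/
abbrev DyadicIndex : Type := Σ n : ℕ, Fin (2 ^ n)

/-- The length of a dyadic interval. -/
def len (I : DyadicIndex) : ℝ := ((2 : ℝ) ^ I.1)⁻¹

/-- The left endpoint of a dyadic interval. -/
def lo (I : DyadicIndex) : ℝ := (I.2 : ℕ) * len I

/-- The dyadic interval with index `I`. -/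
def interval (I : DyadicIndex) : Set ℝ := Ico (lo I) (lo I + len I)

/-- The average of a nonnegative function over a dyadic interval. -/
def avg (g : ℝ → ℝ≥0∞) (I : DyadicIndex) : ℝ≥0∞ :=
  (∫⁻ x in interval I, g x) / ENNReal.ofReal (len I)

/-- The left half of a dyadic interval. -/
def leftHalf (I : DyadicIndex) : Set ℝ := Ico (lo I) (lo I + len I / 2)

/-- The right half of a dyadic interval. -/
def rightHalf (I : DyadicIndex) : Set ℝ := Ico (lo I + len I / 2) (lo I + len I)

/-- The Haar function of a dyadic interval, normalized in `L²(dx)`. -/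
def haar (I : DyadicIndex) (x : ℝ) : ℝ :=
  (Real.sqrt (len I))⁻¹ *
    ((rightHalf I).indicator (fun _ => 1) x - (leftHalf I).indicator (fun _ => 1) x)

/-- A weight on `[0,1)`: measurable, strictly positive and integrable there.
(The values outside `[0,1)` are never used.) -/
structure IsWeight (w : ℝ → ℝ) : Prop where
  measurable : Measurable w
  pos : ∀ x ∈ Ico (0 : ℝ) 1, 0 < w x
  integrableOn : IntegrableOn w (Ico 0 1)

/-- The dyadic `A₂` characteristic: the supremum over the dyadic `I ⊆ [0,1)` of the product of
the averages over `I` of `w` and of `w⁻¹`. -/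
def a2Char (w : ℝ → ℝ) : ℝ≥0∞ :=
  ⨆ I : DyadicIndex,
    avg (fun x => ENNReal.ofReal (w x)) I * avg (fun x => ENNReal.ofReal ((w x)⁻¹)) I

/-- The measure `w dx` on `[0,1)`. -/
def weightMeasure (w : ℝ → ℝ) : Measure ℝ :=
  (volume.restrict (Ico (0 : ℝ) 1)).withDensity fun x => ENNReal.ofReal (w x)

/-- The dyadic maximal function: the supremum over the dyadic `I` containing `x` of the average
of `|f|` over `I`. -/
def maximalFn (f : ℝ → ℝ) (x : ℝ) : ℝ≥0∞ :=
  ⨆ I : DyadicIndex, (interval I).indicator (fun _ => avg (fun y => ‖f y‖ₑ) I) x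

/-- The dyadic square function, the square root of the sum over all dyadic `I` of
`(f, h_I)² χ_I(x) / |I|`. -/
def squareFn (f : ℝ → ℝ) (x : ℝ) : ℝ≥0∞ :=
  (∑' I : DyadicIndex,
    (interval I).indicator
      (fun _ => ENNReal.ofReal ((∫ y, f y * haar I y) ^ 2 / len I)) x) ^ (1 / 2 : ℝ)

/-- The square function with the weight inside: `S_w f = S (w f)`. -/
def squareFnW (w : ℝ → ℝ) (f : ℝ → ℝ) : ℝ → ℝ≥0∞ := squareFn fun x => w x * f x

/-- The `L^{2,1}(μ)` norm, `∫₀^∞ μ {|f| > t} ^ (1/2) dt`. -/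
def lorentzNorm (f : ℝ → ℝ) (μ : Measure ℝ) : ℝ≥0∞ :=
  ∫⁻ t in Ioi (0 : ℝ), μ {x | t < |f x|} ^ (1 / 2 : ℝ)

/-- The norm of an operator `T : L²(μ) → L²(ν)`: the supremum of `‖T f‖_{L²(ν)}` over the unit
ball of `L²(μ)`. -/
def normL2 (T : (ℝ → ℝ) → ℝ → ℝ≥0∞) (μ ν : Measure ℝ) : ℝ≥0∞ :=
  ⨆ (f : ℝ → ℝ) (_ : AEStronglyMeasurable f μ) (_ : eLpNorm f 2 μ ≤ 1), eLpNorm (T f) 2 ν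

/-- The norm of an operator `T : L^{2,1}(μ) → L²(ν)`: the supremum of `‖T f‖_{L²(ν)}` over the
`f` with `‖f‖_{L^{2,1}(μ)} ≤ 1`. -/
def normL21 (T : (ℝ → ℝ) → ℝ → ℝ≥0∞) (μ ν : Measure ℝ) : ℝ≥0∞ :=
  ⨆ (f : ℝ → ℝ) (_ : AEStronglyMeasurable f μ) (_ : lorentzNorm f μ ≤ 1), eLpNorm (T f) 2 ν

/-- `‖M^d‖_w`, the norm of the dyadic maximal operator on `L²(w)`. -/
def maximalNorm (w : ℝ → ℝ) : ℝ≥0∞ := normL2 maximalFn (weightMeasure w) (weightMeasure w)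

/-- `‖S‖_w`, the norm of the dyadic square function operator on `L²(w)`. -/
def squareNorm (w : ℝ → ℝ) : ℝ≥0∞ := normL2 squareFn (weightMeasure w) (weightMeasure w)

/-- `t √(log t)`, for `t ∈ [1, ∞]` (with value `∞` at `∞`). -/
def mulSqrtLog (t : ℝ≥0∞) : ℝ≥0∞ := t * (ENNReal.log t).toENNReal ^ (1 / 2 : ℝ)

end DyadicWeights

end

/-!
The weights are step functions on `[0,1)`, encoded by finite binary trees (`StepTree`), so that all
averages, square functions and testing quantities are given by finite recursions on trees. Write
`σ = w⁻¹`, and `⟨w⟩`, `⟨σ⟩` for averages.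

**Reduction.** By Sawyer's theorem (`maximalNorm_inv_le`) the norm of `M` on `L²(σ)` is controlled
by the testing integrals `∫_I M(w χ_I)² σ ≤ K w(I)`. The proof is an induction on the number of
levels with the Bellman function of the Carleson embedding theorem (`theta_le`). On the other hand
`(S w)²` integrates against `σ` to `∑ |I| ((⟨w⟩_{I₊} - ⟨w⟩_{I₋}) / 2)² ⟨σ⟩_I`, and testing `S_w` on a
constant function shows that the norms of `S_w` from `L²(w)` and from `L^{2,1}(w)` to `L²(σ)` are at
least the square root of this sum divided by `w([0,1))` (`le_norms_squareFnW`). That `[w] ≤ ‖M‖²`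
is tested on `w χ_I`. Since `f ↦ w f` is an isometry from `L²(w)` onto `L²(σ)`, the norm of `S_w`
is that of `S` on `L²(σ)`, and `S` on `L²(w)` is estimated by exchanging `w` and `σ`.

**Construction.** Let `E = 4 ^ T`. The weight `climb` is built of cells with `⟨w⟩ = a` and
`⟨σ⟩ = q / a`, where `q ≈ E`. Such a cell starts with a nested chain of intervals on which `⟨w⟩`
oscillates between `a` and `5 a / 4`, while `⟨σ⟩` grows geometrically from `q / a` to about
`E ^ 2 / a` in `2 T` steps; so the product `⟨w⟩ ⟨σ⟩` reaches the size `E ^ 2`. On each interval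
split off from the chain the weight behaves for one step like a power weight: `⟨w⟩` nearly doubles
on one half, which is the next cell, and becomes about `a / E` on the other half, a leaf. Each step
of the chain adds about `q a` to the square function, since `σ` is concentrated on the chain; but
the chain adds to the maximal function only once, since `⟨w⟩` does not grow along it. Only a
fraction of order `1 / E` of the mass of `w` is lost per cell. The contributions of the cells
therefore form a geometric series with ratio `1 - O(1 / E)`, and after many cells
`∫ (S w)² σ ≳ T E ^ 2 w([0,1))` (`le_sq_climb`), whereas the testing constant of `w` is
`O(E ^ 2)` (`psi_climb`). For the reciprocal weight the testing constant is `O(E ^ 2)` even for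
the Carleson sums over all intervals (`carl_climb`), because the terms grow geometrically along
the chains. So `[w]`, `‖M‖²` are comparable to `E ^ 2` and `‖S‖²` is at least of order
`E ^ 2 log E`. The final weight carries `climb` on the left half of `[0,1)` and the reciprocal of
`climb` on the right half, which makes the estimates symmetric in `w` and `w⁻¹`
(`exists_stepTree`).
-/

/-! ### Step functions as binary trees -/

namespace DyadicWeights

/-- A finite binary tree with real values at the leaves. It encodes a step function on `[0,1)`:
the two children of a node describe the function on the two halves of an interval. -/
inductive StepTree where
  | leaf (c : ℝ) : StepTree
  | node (l r : StepTree) : StepTree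

namespace StepTree

/-- The average of the step function. -/
noncomputable def mean : StepTree → ℝ
  | leaf c => c
  | node l r => (mean l + mean r) / 2

/-- The tree of the reciprocal step function. -/
noncomputable def inv : StepTree → StepTree
  | leaf c => leaf c⁻¹
  | node l r => node l.inv r.inv

/-- The height of the tree. -/
def depth : StepTree → ℕ
  | leaf _ => 0
  | node l r => max l.depth r.depth + 1

/-- The restriction to the left half; a leaf stands for a constant, so it is its own half. -/
def left : StepTree → StepTree
  | leaf c => leaf c
  | node l _ => l

/-- The restriction to the right half. -/
def right : StepTree → StepTree
  | leaf c => leaf c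
  | node _ r => r

/-- The subtree over the dyadic interval `[k / 2 ^ n, (k + 1) / 2 ^ n)`. -/
def desc (t : StepTree) : ℕ → ℕ → StepTree
  | 0, _ => t
  | n + 1, k => if k % 2 = 0 then (desc t n (k / 2)).left else (desc t n (k / 2)).right

/-- `All P t`: the tree `t` and all its subtrees satisfy `P`. -/
def All (P : StepTree → Prop) : StepTree → Prop
  | leaf c => P (leaf c)
  | node l r => P (node l r) ∧ All P l ∧ All P r

/-- All leaves carry positive values. -/
def Pos : StepTree → Prop
  | leaf c => 0 < c
  | node l r => Pos l ∧ Pos r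

/-- The average of `max(m, M w)² w⁻¹`, where `M` is the dyadic maximal operator localized to the
interval carrying the step function `w`. For `m = 0` this is the quantity in the testing
condition for the boundedness of `M` on `L²(w⁻¹)`. -/
noncomputable def psi : StepTree → ℝ → ℝ
  | leaf c, m => max m c ^ 2 / c
  | node l r, m =>
    (psi l (max m ((mean l + mean r) / 2)) + psi r (max m ((mean l + mean r) / 2))) / 2

/-- The average of `(S w)² w⁻¹`, with `S` the dyadic square function. -/
noncomputable def sq : StepTree → ℝ
  | leaf _ => 0
  | node l r => ((mean r - mean l) / 2) ^ 2 * ((mean l.inv + mean r.inv) / 2) + (sq l + sq r) / 2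

theorem inv_inv (t : StepTree) : t.inv.inv = t := by
  induction t with
  | leaf c => simp [inv]
  | node l r hl hr => simp [inv, hl, hr]

theorem inv_left (t : StepTree) : t.inv.left = t.left.inv := by cases t <;> rfl

theorem inv_right (t : StepTree) : t.inv.right = t.right.inv := by cases t <;> rfl

theorem inv_desc (t : StepTree) (n k : ℕ) : t.inv.desc n k = (t.desc n k).inv := by
  induction n generalizing k with
  | zero => rfl
  | succ n ih =>
    simp only [desc, ih, inv_left, inv_right]
    split_ifs <;> rfl

theorem depth_inv (t : StepTree) : t.inv.depth = t.depth := by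
  induction t with
  | leaf c => rfl
  | node l r hl hr => simp [inv, depth, hl, hr]

theorem desc_two_mul (t : StepTree) (n k : ℕ) : t.desc (n + 1) (2 * k) = (t.desc n k).left := by
  simp [desc]

theorem desc_two_mul_add_one (t : StepTree) (n k : ℕ) :
    t.desc (n + 1) (2 * k + 1) = (t.desc n k).right := by
  have h1 : (2 * k + 1) / 2 = k := by omega
  have h2 : (2 * k + 1) % 2 = 1 := by omega
  simp [desc, h1, h2]

theorem mean_eq (t : StepTree) : t.mean = (t.left.mean + t.right.mean) / 2 := by
  cases t with
  | leaf c => simp [left, right]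
  | node l r => rfl

theorem psi_eq (t : StepTree) (m : ℝ) :
    t.psi m = (t.left.psi (max m t.mean) + t.right.psi (max m t.mean)) / 2 := by
  cases t with
  | leaf c => simp [left, right, psi, mean]
  | node l r => rfl

theorem sq_eq (t : StepTree) :
    t.sq = ((t.right.mean - t.left.mean) / 2) ^ 2 * t.inv.mean + (t.left.sq + t.right.sq) / 2 := by
  cases t with
  | leaf c => simp [left, right, sq, mean]
  | node l r => rfl

theorem Pos.inv {t : StepTree} (h : t.Pos) : t.inv.Pos := by
  induction t with
  | leaf c => exact inv_pos.2 h
  | node l r hl hr => exact ⟨hl h.1, hr h.2⟩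

theorem Pos.left {t : StepTree} (h : t.Pos) : t.left.Pos := by
  cases t with
  | leaf c => exact h
  | node l r => exact h.1

theorem Pos.right {t : StepTree} (h : t.Pos) : t.right.Pos := by
  cases t with
  | leaf c => exact h
  | node l r => exact h.2

theorem Pos.desc {t : StepTree} (h : t.Pos) (n k : ℕ) : (t.desc n k).Pos := by
  induction n generalizing k with
  | zero => exact h
  | succ n ih =>
    simp only [StepTree.desc]
    split_ifs
    exacts [(ih _).left, (ih _).right]

theorem Pos.mean_pos {t : StepTree} (h : t.Pos) : 0 < t.mean := by
  induction t with
  | leaf c => exact h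
  | node l r hl hr =>
    have := hl h.1
    have := hr h.2
    simp only [mean]
    positivity

theorem All.self {P : StepTree → Prop} {t : StepTree} (h : All P t) : P t := by
  cases t with
  | leaf c => exact h
  | node l r => exact h.1

theorem All.desc {P : StepTree → Prop} {t : StepTree} (h : All P t) (n k : ℕ) :
    P (t.desc n k) := by
  suffices h' : All P (t.desc n k) from h'.self
  induction n generalizing k with
  | zero => exact h
  | succ n ih =>
    have := ih (k / 2)
    simp only [StepTree.desc]
    cases hs : t.desc n (k / 2) with
    | leaf c => rw [hs] at this; simpa [left, right] using this
    | node l r =>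
      rw [hs] at this
      split_ifs
      exacts [this.2.1, this.2.2]

theorem depth_desc_le (t : StepTree) (n k : ℕ) : (t.desc n k).depth ≤ t.depth - n := by
  induction n generalizing k with
  | zero => simp [desc]
  | succ n ih =>
    have := ih (k / 2)
    simp only [desc]
    cases hs : t.desc n (k / 2) with
    | leaf c => simp [left, right, depth]
    | node l r =>
      rw [hs] at this
      simp only [depth] at this
      split_ifs <;> simp only [left, right] <;> omega

theorem exists_leaf_of_depth_le {t : StepTree} {n : ℕ} (h : t.depth ≤ n) (k : ℕ) :
    ∃ c, t.desc n k = leaf c := by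
  have := depth_desc_le t n k
  cases hs : t.desc n k with
  | leaf c => exact ⟨c, rfl⟩
  | node l r =>
    rw [hs] at this
    simp only [depth] at this
    omega

/-- A localized maximal function is at least the average over the whole interval. -/
theorem le_psi {t : StepTree} (h : t.Pos) {m : ℝ} (hm : 0 ≤ m) :
    max m t.mean ^ 2 * t.inv.mean ≤ t.psi m := by
  induction t generalizing m with
  | leaf c => simp [psi, mean, inv, div_eq_mul_inv]
  | node l r hl hr =>
    have hm' : 0 ≤ max m ((mean l + mean r) / 2) := le_max_of_le_left hm
    have h1 := hl h.1 hm'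
    have h2 := hr h.2 hm'
    have p1 := h.1.inv.mean_pos
    have p2 := h.2.inv.mean_pos
    simp only [psi, mean, inv]
    set M := max m ((mean l + mean r) / 2)
    have h3 : M ^ 2 ≤ max M l.mean ^ 2 := by gcongr; exact le_max_left _ _
    have h4 : M ^ 2 ≤ max M r.mean ^ 2 := by gcongr; exact le_max_left _ _
    nlinarith [mul_le_mul_of_nonneg_right h3 p1.le, mul_le_mul_of_nonneg_right h4 p2.le]

/-- Raising the floor `m` costs at most `m²` times the average of `w⁻¹`. -/
theorem psi_le_add {t : StepTree} (h : t.Pos) {m : ℝ} (hm : 0 ≤ m) :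
    t.psi m ≤ m ^ 2 * t.inv.mean + t.psi 0 := by
  suffices H : ∀ m' : ℝ, 0 ≤ m' → t.psi (max m m') ≤ m ^ 2 * t.inv.mean + t.psi m' by
    simpa [max_eq_left hm] using H 0 le_rfl
  induction t with
  | leaf c =>
    intro m' hm'
    have hc : 0 < c := h
    simp only [psi, mean, inv, ← div_eq_mul_inv, ← add_div]
    gcongr
    rw [max_assoc]
    rcases max_cases m (max m' c) with ⟨h1, _⟩ | ⟨h1, _⟩ <;> rw [h1]
    · nlinarith [sq_nonneg (max m' c)]
    · nlinarith [sq_nonneg m]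
  | node l r hl hr =>
    intro m' hm'
    have h1 := hl h.1 (max m' ((mean l + mean r) / 2)) (le_max_of_le_left hm')
    have h2 := hr h.2 (max m' ((mean l + mean r) / 2)) (le_max_of_le_left hm')
    simp only [psi, mean, inv, max_assoc]
    linarith

end StepTree

/-! ### The Bellman function argument for the maximal operator -/

/-- The average, over the dyadic interval `(n, k)`, of the square of the maximum of `m` and of the
numbers `x n' k'` over the dyadic intervals of the `d + 1` levels from `n` on that contain the
point, with respect to a weight with averages `v`. -/
noncomputable def theta (x v : ℕ → ℕ → ℝ) : ℕ → ℕ → ℕ → ℝ → ℝ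
  | 0, n, k, m => max m (x n k) ^ 2 * v n k
  | d + 1, n, k, m =>
    (theta x v d (n + 1) (2 * k) (max m (x n k)) +
      theta x v d (n + 1) (2 * k + 1) (max m (x n k))) / 2

/-- The function `(x, τ) ↦ x² / τ` is convex and homogeneous. -/
theorem sq_div_add_le {x y s t : ℝ} (hs : 0 < s) (ht : 0 < t) :
    ((x + y) / 2) ^ 2 / ((s + t) / 2) ≤ (x ^ 2 / s + y ^ 2 / t) / 2 := by
  rw [div_add_div _ _ hs.ne' ht.ne', div_div, div_le_div_iff₀ (by positivity) (by positivity)]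
  nlinarith [mul_nonneg (add_pos hs ht).le (sq_nonneg (x * t - y * s))]

/-- The gain in the Bellman function when the Carleson sum jumps by `a`. -/
theorem carleson_jump {x τ T a K : ℝ} (hK : 0 < K) (hτ : 0 < τ) (ha : 0 ≤ a) (hT : τ ≤ T)
    (hT2 : T + a / K ≤ 2 * τ) :
    a * (x / τ) ^ 2 ≤ 4 * K * (x ^ 2 / T - x ^ 2 / (T + a / K)) := by
  have hT0 : 0 < T := hτ.trans_le hT
  have haK : 0 ≤ a / K := by positivity
  have e : 4 * K * (x ^ 2 / T - x ^ 2 / (T + a / K)) = 4 * a * x ^ 2 / (T * (T + a / K)) := by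
    field_simp
    ring
  rw [e, div_pow, mul_div_assoc', div_le_div_iff₀ (by positivity) (by positivity)]
  have h1 : T * (T + a / K) ≤ 4 * τ ^ 2 := by nlinarith
  calc a * x ^ 2 * (T * (T + a / K)) ≤ a * x ^ 2 * (4 * τ ^ 2) := by gcongr
    _ = 4 * a * x ^ 2 * τ ^ 2 := by ring

/-- The Bellman function induction behind Sawyer's theorem. The number `e` is the mass (with respect
to `w⁻¹`) of the set where the maximum is the floor `m`, and `A` is the part of the testing
integral that comes from the rest; the last term contains the Bellman function of the Carleson
embedding theorem. -/
theorem theta_le {t : StepTree} (ht : t.Pos) {K : ℝ} (hK : 0 < K)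
    (htest : ∀ n k, (t.desc n k).psi 0 ≤ K * (t.desc n k).mean)
    {x F : ℕ → ℕ → ℝ} (hx : ∀ n k, x n k = (x (n + 1) (2 * k) + x (n + 1) (2 * k + 1)) / 2)
    (hF : ∀ n k, F n k = (F (n + 1) (2 * k) + F (n + 1) (2 * k + 1)) / 2)
    (hxF : ∀ n k, x n k ^ 2 ≤ F n k * (t.desc n k).mean) (d n k : ℕ) (m : ℝ) (hm : 0 ≤ m) :
    ∃ e A : ℝ, 0 ≤ e ∧ 0 ≤ A ∧ (∀ m', 0 ≤ m' → e * m' ^ 2 + A ≤ (t.desc n k).psi m') ∧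
      theta x (fun n k => (t.desc n k).inv.mean) d n k m ≤
        e * m ^ 2 + 4 * K * (F n k - x n k ^ 2 / ((t.desc n k).mean + A / K)) := by
  induction d generalizing n k m with
  | zero =>
    have hs := ht.desc n k
    have hτ := hs.mean_pos
    have hv := hs.inv.mean_pos
    have hψ := fun m' (hm' : 0 ≤ m') => StepTree.le_psi hs hm'
    have hF' : x n k ^ 2 / (t.desc n k).mean ≤ F n k := (div_le_iff₀ hτ).2 (hxF n k)
    have htest' := htest n k
    simp only [theta]
    set s := t.desc n k
    rcases le_total (x n k) m with h | h
    · refine ⟨s.inv.mean, 0, hv.le, le_rfl, fun m' hm' => ?_, ?_⟩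
      · refine le_trans ?_ (hψ m' hm')
        rw [add_zero, mul_comm]
        gcongr
        exact le_max_left _ _
      · rw [max_eq_left h, zero_div, add_zero]
        nlinarith
    · have hA : s.mean ^ 2 * s.inv.mean ≤ s.psi 0 := by
        simpa [max_eq_right hτ.le] using hψ 0 le_rfl
      refine ⟨0, s.mean ^ 2 * s.inv.mean, le_rfl, by positivity, fun m' hm' => ?_, ?_⟩
      · refine le_trans ?_ (hψ m' hm')
        rw [zero_mul, zero_add]
        gcongr
        exact le_max_right _ _
      · rw [max_eq_right h]
        have hj := carleson_jump (x := x n k) hK hτ (a := s.mean ^ 2 * s.inv.mean) (by positivity)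
          le_rfl (by
            have : s.mean ^ 2 * s.inv.mean / K ≤ s.mean := by
              rw [div_le_iff₀ hK]; linarith
            linarith)
        have e1 : s.mean ^ 2 * s.inv.mean * (x n k / s.mean) ^ 2 = x n k ^ 2 * s.inv.mean := by
          field_simp
        rw [e1] at hj
        nlinarith
  | succ d ih =>
    have hs := ht.desc n k
    have hτ := hs.mean_pos
    have hm' : 0 ≤ max m (x n k) := le_max_of_le_left hm
    obtain ⟨e₁, A₁, he₁, hA₁, hψ₁, hθ₁⟩ := ih (n + 1) (2 * k) _ hm'
    obtain ⟨e₂, A₂, he₂, hA₂, hψ₂, hθ₂⟩ := ih (n + 1) (2 * k + 1) _ hm'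
    have hτ₁ := (ht.desc (n + 1) (2 * k)).mean_pos
    have hτ₂ := (ht.desc (n + 1) (2 * k + 1)).mean_pos
    rw [StepTree.desc_two_mul] at hψ₁ hθ₁ hτ₁
    rw [StepTree.desc_two_mul_add_one] at hψ₂ hθ₂ hτ₂
    have htest' := htest n k
    have hmean := (t.desc n k).mean_eq
    have hpsi := (t.desc n k).psi_eq
    simp only [theta]
    set s := t.desc n k
    set Y := (x (n + 1) (2 * k) ^ 2 / (s.left.mean + A₁ / K) +
      x (n + 1) (2 * k + 1) ^ 2 / (s.right.mean + A₂ / K)) / 2 with hY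
    have hconv : x n k ^ 2 / (s.mean + (A₁ + A₂) / 2 / K) ≤ Y := by
      have := sq_div_add_le (x := x (n + 1) (2 * k)) (y := x (n + 1) (2 * k + 1))
        (s := s.left.mean + A₁ / K) (t := s.right.mean + A₂ / K) (by positivity) (by positivity)
      rw [← hx n k] at this
      convert this using 2
      rw [hmean]
      ring
    have hθ : (theta x (fun n k => (t.desc n k).inv.mean) d (n + 1) (2 * k) (max m (x n k)) +
        theta x (fun n k => (t.desc n k).inv.mean) d (n + 1) (2 * k + 1) (max m (x n k))) / 2 ≤
        (e₁ + e₂) / 2 * max m (x n k) ^ 2 + 4 * K * (F n k - Y) := by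
      rw [hF n k, hY]
      linarith
    have hψ : ∀ m', 0 ≤ m' →
        (e₁ + e₂) / 2 * max m' s.mean ^ 2 + (A₁ + A₂) / 2 ≤ s.psi m' := by
      intro m' h0
      rw [hpsi m']
      have h0' : 0 ≤ max m' s.mean := le_max_of_le_left h0
      linarith [hψ₁ _ h0', hψ₂ _ h0']
    -- If `x n k` is a new maximum, the mass `(e₁ + e₂) / 2` moves from the floor to the Carleson sum.
    rcases le_total (x n k) m with h | h
    · refine ⟨(e₁ + e₂) / 2, (A₁ + A₂) / 2, by positivity, by positivity, fun m' h0 => ?_, ?_⟩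
      · refine le_trans ?_ (hψ m' h0)
        gcongr
        exact le_max_left _ _
      · rw [max_eq_left h] at hθ ⊢
        refine hθ.trans ?_
        gcongr
    · set a := (e₁ + e₂) / 2 * s.mean ^ 2 with ha
      have ha0 : 0 ≤ a := by positivity
      have hA : a + (A₁ + A₂) / 2 ≤ s.psi 0 := by
        simpa [max_eq_right hτ.le] using hψ 0 le_rfl
      refine ⟨0, (A₁ + A₂) / 2 + a, le_rfl, by positivity, fun m' h0 => ?_, ?_⟩
      · refine le_trans ?_ (hψ m' h0)
        have : a ≤ (e₁ + e₂) / 2 * max m' s.mean ^ 2 := by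
          rw [ha]
          gcongr
          exact le_max_right _ _
        linarith
      · rw [max_eq_right h] at hθ ⊢
        have hj := carleson_jump (x := x n k) (T := s.mean + (A₁ + A₂) / 2 / K) hK hτ ha0
          (by have : 0 ≤ (A₁ + A₂) / 2 / K := by positivity
              linarith) (by
            have : (a + (A₁ + A₂) / 2) / K ≤ s.mean := by
              rw [div_le_iff₀ hK]; linarith
            rw [add_div] at this
            linarith)
        have e1 : a * (x n k / s.mean) ^ 2 = (e₁ + e₂) / 2 * x n k ^ 2 := by
          rw [ha]; field_simp
        rw [e1, add_assoc, ← add_div] at hj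
        refine hθ.trans ?_
        have : 4 * K * (x n k ^ 2 / (s.mean + (A₁ + A₂) / 2 / K)) ≤ 4 * K * Y := by gcongr
        linarith

/-! ### Dyadic cells and integrals of step weights -/

/-- The interval `[k / 2 ^ n, (k + 1) / 2 ^ n)`, without the restriction `k < 2 ^ n`. -/
def cell (n k : ℕ) : Set ℝ := Ico (k * ((2 : ℝ) ^ n)⁻¹) ((k + 1) * ((2 : ℝ) ^ n)⁻¹)

theorem interval_eq_cell (I : DyadicIndex) : interval I = cell I.1 I.2 := by
  simp only [interval, cell, lo, len]
  congr 1
  ring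

theorem measurableSet_cell (n k : ℕ) : MeasurableSet (cell n k) := measurableSet_Ico

theorem cell_zero_zero : cell 0 0 = Ico 0 1 := by simp [cell]

theorem volume_cell (n k : ℕ) : volume (cell n k) = ENNReal.ofReal ((2 : ℝ) ^ n)⁻¹ := by
  rw [cell, Real.volume_Ico]
  congr 1
  ring

theorem mem_cell_iff {n k : ℕ} {x : ℝ} : x ∈ cell n k ↔ 0 ≤ x ∧ ⌊(2 : ℝ) ^ n * x⌋₊ = k := by
  have h2 : (0 : ℝ) < 2 ^ n := by positivity
  rw [cell, mem_Ico, ← div_eq_mul_inv, ← div_eq_mul_inv, div_le_iff₀ h2, lt_div_iff₀ h2,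
    mul_comm x]
  constructor
  · rintro ⟨h, h'⟩
    have h0 : 0 ≤ (2 : ℝ) ^ n * x := (Nat.cast_nonneg k).trans h
    exact ⟨nonneg_of_mul_nonneg_right h0 h2, (Nat.floor_eq_iff h0).2 ⟨h, h'⟩⟩
  · rintro ⟨h, h'⟩
    exact (Nat.floor_eq_iff (by positivity)).1 h'

theorem floor_succ_div_two (n : ℕ) (x : ℝ) :
    ⌊(2 : ℝ) ^ (n + 1) * x⌋₊ / 2 = ⌊(2 : ℝ) ^ n * x⌋₊ := by
  rw [← Nat.floor_div_ofNat]
  congr 1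
  rw [pow_succ]
  ring

theorem cell_eq_union (n k : ℕ) :
    cell n k = cell (n + 1) (2 * k) ∪ cell (n + 1) (2 * k + 1) := by
  ext x
  have h := floor_succ_div_two n x
  simp only [mem_union, mem_cell_iff]
  constructor
  · rintro ⟨h0, h1⟩
    have : ⌊(2 : ℝ) ^ (n + 1) * x⌋₊ = 2 * k ∨ ⌊(2 : ℝ) ^ (n + 1) * x⌋₊ = 2 * k + 1 := by omega
    tauto
  · rintro (⟨h0, h1⟩ | ⟨h0, h1⟩) <;> exact ⟨h0, by omega⟩

theorem disjoint_cell {n k l : ℕ} (h : k ≠ l) : Disjoint (cell n k) (cell n l) := by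
  rw [Set.disjoint_left]
  intro x hx hx'
  rw [mem_cell_iff] at hx hx'
  exact h (hx.2.symm.trans hx'.2)

theorem cell_left_subset (n k : ℕ) : cell (n + 1) (2 * k) ⊆ cell n k := by
  rw [cell_eq_union n k]; exact subset_union_left

theorem cell_right_subset (n k : ℕ) : cell (n + 1) (2 * k + 1) ⊆ cell n k := by
  rw [cell_eq_union n k]; exact subset_union_right

theorem cell_subset_Ico {n k : ℕ} (h : k < 2 ^ n) : cell n k ⊆ Ico 0 1 := by
  have h2 : (0 : ℝ) < 2 ^ n := by positivity
  refine Ico_subset_Ico (by positivity) ?_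
  rw [← div_eq_mul_inv, div_le_one h2]
  exact_mod_cast h

theorem lintegral_cell_split (g : ℝ → ℝ≥0∞) (n k : ℕ) :
    ∫⁻ x in cell n k, g x =
      (∫⁻ x in cell (n + 1) (2 * k), g x) + ∫⁻ x in cell (n + 1) (2 * k + 1), g x := by
  rw [cell_eq_union n k,
    lintegral_union (measurableSet_cell _ _) (disjoint_cell (by omega))]

theorem ofReal_half_add {n : ℕ} {a b : ℝ} (ha : 0 ≤ a) (hb : 0 ≤ b) :
    ENNReal.ofReal (((2 : ℝ) ^ (n + 1))⁻¹ * a) + ENNReal.ofReal (((2 : ℝ) ^ (n + 1))⁻¹ * b) =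
      ENNReal.ofReal (((2 : ℝ) ^ n)⁻¹ * ((a + b) / 2)) := by
  rw [← ENNReal.ofReal_add (by positivity) (by positivity)]
  congr 1
  rw [pow_succ]
  field_simp

namespace StepTree

/-- The step function encoded by a tree. Outside `[0,1)` it also takes values at leaves of the tree,
so it is positive on the whole line if the tree is. -/
noncomputable def toFun (t : StepTree) (x : ℝ) : ℝ :=
  (t.desc t.depth ⌊(2 : ℝ) ^ t.depth * x⌋₊).mean

/-- Any level at which all subtrees are leaves may be used to evaluate the step function. -/
theorem toFun_eq (t : StepTree) {D : ℕ} (hD : t.depth ≤ D) (x : ℝ) :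
    t.toFun x = (t.desc D ⌊(2 : ℝ) ^ D * x⌋₊).mean := by
  induction D, hD using Nat.le_induction with
  | base => rfl
  | succ D hD ih =>
    obtain ⟨c, hc⟩ := exists_leaf_of_depth_le hD ⌊(2 : ℝ) ^ D * x⌋₊
    rw [ih, desc, floor_succ_div_two, hc]
    simp [left, right]

theorem toFun_inv (t : StepTree) : t.inv.toFun = (t.toFun)⁻¹ := by
  funext x
  obtain ⟨c, hc⟩ := exists_leaf_of_depth_le (le_refl t.depth) ⌊(2 : ℝ) ^ t.depth * x⌋₊
  simp [toFun, depth_inv, inv_desc, hc, inv, mean]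

theorem toFun_pos {t : StepTree} (h : t.Pos) (x : ℝ) : 0 < t.toFun x := (h.desc _ _).mean_pos

theorem measurable_toFun (t : StepTree) : Measurable t.toFun :=
  (measurable_from_nat (f := fun k => (t.desc t.depth k).mean)).comp
    (Nat.measurable_floor.comp (measurable_const.mul measurable_id))

theorem lintegral_toFun {t : StepTree} (h : t.Pos) (n k : ℕ) :
    ∫⁻ x in cell n k, ENNReal.ofReal (t.toFun x) =
      ENNReal.ofReal (((2 : ℝ) ^ n)⁻¹ * (t.desc n k).mean) := by
  suffices H : ∀ i n k, t.depth ≤ n + i → ∫⁻ x in cell n k, ENNReal.ofReal (t.toFun x) =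
      ENNReal.ofReal (((2 : ℝ) ^ n)⁻¹ * (t.desc n k).mean) from
    H t.depth n k (Nat.le_add_left _ _)
  intro i
  induction i with
  | zero =>
    intro n k hn
    have : ∀ x ∈ cell n k, ENNReal.ofReal (t.toFun x) = ENNReal.ofReal (t.desc n k).mean := by
      intro x hx
      rw [t.toFun_eq (D := n) hn, (mem_cell_iff.1 hx).2]
    rw [setLIntegral_congr_fun (measurableSet_cell n k) this, setLIntegral_const, volume_cell,
      mul_comm, ENNReal.ofReal_mul (by positivity)]
  | succ i ih =>
    intro n k hn
    rw [lintegral_cell_split, ih _ _ (by omega), ih _ _ (by omega), desc_two_mul,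
      desc_two_mul_add_one, (t.desc n k).mean_eq,
      ofReal_half_add (h.desc n k).left.mean_pos.le (h.desc n k).right.mean_pos.le]

theorem isWeight_toFun {t : StepTree} (h : t.Pos) : IsWeight t.toFun where
  measurable := t.measurable_toFun
  pos x _ := toFun_pos h x
  integrableOn := by
    refine ⟨t.measurable_toFun.aestronglyMeasurable, ?_⟩
    rw [hasFiniteIntegral_iff_ofReal (ae_of_all _ fun x => (toFun_pos h x).le), ← cell_zero_zero,
      lintegral_toFun h]
    exact ENNReal.ofReal_lt_top

theorem avg_toFun {t : StepTree} (h : t.Pos) (I : DyadicIndex) :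
    avg (fun x => ENNReal.ofReal (t.toFun x)) I = ENNReal.ofReal (t.desc I.1 I.2).mean := by
  have hl : 0 < ((2 : ℝ) ^ I.1)⁻¹ := by positivity
  rw [avg, interval_eq_cell, lintegral_toFun h, len, ← ENNReal.ofReal_div_of_pos hl]
  congr 1
  field_simp

theorem a2Char_toFun {t : StepTree} (h : t.Pos) :
    a2Char t.toFun = ⨆ I : DyadicIndex,
      ENNReal.ofReal ((t.desc I.1 I.2).mean * (t.desc I.1 I.2).inv.mean) := by
  rw [a2Char]
  congr 1
  funext I
  have : (fun x => ENNReal.ofReal ((t.toFun x)⁻¹)) =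
      fun x => ENNReal.ofReal (t.inv.toFun x) := by rw [toFun_inv]; rfl
  rw [this, avg_toFun h, avg_toFun h.inv, inv_desc, ENNReal.ofReal_mul (h.desc _ _).mean_pos.le]

end StepTree

theorem lintegral_weightMeasure {w : ℝ → ℝ} (hw : Measurable w) (g : ℝ → ℝ≥0∞) :
    ∫⁻ x, g x ∂weightMeasure w = ∫⁻ x in Ico (0 : ℝ) 1, ENNReal.ofReal (w x) * g x := by
  rw [weightMeasure, lintegral_withDensity_eq_lintegral_mul_non_measurable _ hw.ennreal_ofReal
    (ae_of_all _ fun _ => ENNReal.ofReal_lt_top)]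
  rfl

theorem restrict_absolutelyContinuous_weightMeasure {w : ℝ → ℝ} (hw : Measurable w)
    (hpos : ∀ x, 0 < w x) : volume.restrict (Ico (0 : ℝ) 1) ≪ weightMeasure w :=
  withDensity_absolutelyContinuous' hw.ennreal_ofReal.aemeasurable
    (ae_of_all _ fun x => (ENNReal.ofReal_pos.2 (hpos x)).ne')

theorem aemeasurable_of_weightMeasure {w f : ℝ → ℝ} (hw : Measurable w) (hpos : ∀ x, 0 < w x)
    (hf : AEStronglyMeasurable f (weightMeasure w)) :
    AEMeasurable f (volume.restrict (Ico (0 : ℝ) 1)) :=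
  (hf.mono_ac (restrict_absolutelyContinuous_weightMeasure hw hpos)).aemeasurable

theorem eLpNorm_two_sq {α ε : Type*} [MeasurableSpace α] [TopologicalSpace ε]
    [ContinuousENorm ε] (f : α → ε) (μ : Measure α) :
    eLpNorm f 2 μ ^ 2 = ∫⁻ x, ‖f x‖ₑ ^ 2 ∂μ := by
  have := eLpNorm_nnreal_pow_eq_lintegral (μ := μ) (f := f) (p := 2) two_ne_zero
  rw [NNReal.coe_ofNat] at this
  simp only [ENNReal.rpow_two] at this
  exact this

theorem eLpNorm_le_iff_sq {α ε : Type*} [MeasurableSpace α] [TopologicalSpace ε]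
    [ContinuousENorm ε] {f : α → ε} {μ : Measure α} {B : ℝ≥0∞} :
    eLpNorm f 2 μ ≤ B ↔ ∫⁻ x, ‖f x‖ₑ ^ 2 ∂μ ≤ B ^ 2 := by
  rw [← eLpNorm_two_sq]
  exact (ENNReal.pow_right_strictMono two_ne_zero).le_iff_le.symm

/-! ### The norm of the dyadic maximal operator -/

/-- The running maximum, starting from the floor `m`, of the numbers `x n' k'` over the dyadic
intervals of the levels `n, …, n + d` that contain the point `y`. -/
noncomputable def runMax (x : ℕ → ℕ → ℝ) : ℕ → ℕ → ℝ → ℝ → ℝ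
  | 0, n, m, y => max m (x n ⌊(2 : ℝ) ^ n * y⌋₊)
  | d + 1, n, m, y => runMax x d (n + 1) (max m (x n ⌊(2 : ℝ) ^ n * y⌋₊)) y

theorem le_runMax (x : ℕ → ℕ → ℝ) (d n : ℕ) (m y : ℝ) :
    x (n + d) ⌊(2 : ℝ) ^ (n + d) * y⌋₊ ≤ runMax x d n m y := by
  induction d generalizing n m with
  | zero => exact le_max_right _ _
  | succ d ih =>
    have := ih (n + 1) (max m (x n ⌊(2 : ℝ) ^ n * y⌋₊))
    rwa [add_right_comm, add_assoc] at this

theorem runMax_mono (x : ℕ → ℕ → ℝ) (n : ℕ) (m y : ℝ) : Monotone fun d => runMax x d n m y := by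
  refine monotone_nat_of_le_succ fun d => ?_
  induction d generalizing n m with
  | zero => exact le_max_left _ _
  | succ d ih => exact ih _ _

theorem measurable_runMax (x : ℕ → ℕ → ℝ) (d n : ℕ) {m : ℝ → ℝ} (hm : Measurable m) :
    Measurable fun y => runMax x d n (m y) y := by
  have h : Measurable fun y : ℝ => x n ⌊(2 : ℝ) ^ n * y⌋₊ :=
    (measurable_from_nat (f := fun k => x n k)).comp
      (Nat.measurable_floor.comp (measurable_const.mul measurable_id))
  induction d generalizing n m with
  | zero => exact hm.max h
  | succ d ih =>
    exact ih (n + 1) (m := fun y => max (m y) (x n ⌊(2 : ℝ) ^ n * y⌋₊)) (hm.max h)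
      ((measurable_from_nat (f := fun k => x (n + 1) k)).comp
      (Nat.measurable_floor.comp (measurable_const.mul measurable_id)))

theorem theta_nonneg {x v : ℕ → ℕ → ℝ} (hv : ∀ n k, 0 ≤ v n k) (d n k : ℕ) (m : ℝ) :
    0 ≤ theta x v d n k m := by
  induction d generalizing n k m with
  | zero => have := hv n k; simp only [theta]; positivity
  | succ d ih =>
    have := ih (n + 1) (2 * k) (max m (x n k))
    have := ih (n + 1) (2 * k + 1) (max m (x n k))
    simp only [theta]
    positivity

theorem lintegral_runMax_sq {s : StepTree} (hs : s.Pos) (x : ℕ → ℕ → ℝ) (d n k : ℕ) {m : ℝ}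
    (hm : 0 ≤ m) :
    ∫⁻ y in cell n k, ENNReal.ofReal (s.toFun y) * ENNReal.ofReal (runMax x d n m y) ^ 2 =
      ENNReal.ofReal (((2 : ℝ) ^ n)⁻¹ * theta x (fun n k => (s.desc n k).mean) d n k m) := by
  have hv : ∀ n k, 0 ≤ (s.desc n k).mean := fun n k => (hs.desc n k).mean_pos.le
  induction d generalizing n k m with
  | zero =>
    have : ∀ y ∈ cell n k, ENNReal.ofReal (s.toFun y) * ENNReal.ofReal (runMax x 0 n m y) ^ 2 =
        ENNReal.ofReal (s.toFun y) * ENNReal.ofReal (max m (x n k)) ^ 2 := by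
      intro y hy
      simp only [runMax]
      rw [(mem_cell_iff.1 hy).2]
    rw [setLIntegral_congr_fun (measurableSet_cell n k) this,
      lintegral_mul_const _ s.measurable_toFun.ennreal_ofReal, StepTree.lintegral_toFun hs,
      ← ENNReal.ofReal_pow (le_max_of_le_left hm), ← ENNReal.ofReal_mul
        (mul_nonneg (by positivity) (hv n k))]
    congr 1
    simp only [theta]
    ring
  | succ d ih =>
    have hm' : 0 ≤ max m (x n k) := le_max_of_le_left hm
    have key : ∀ y ∈ cell n k, runMax x (d + 1) n m y = runMax x d (n + 1) (max m (x n k)) y := by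
      intro y hy
      simp only [runMax]
      rw [(mem_cell_iff.1 hy).2]
    rw [lintegral_cell_split,
      setLIntegral_congr_fun (measurableSet_cell (n + 1) (2 * k)) (fun y hy => by
        rw [key y (cell_left_subset n k hy)]),
      setLIntegral_congr_fun (measurableSet_cell (n + 1) (2 * k + 1)) (fun y hy => by
        rw [key y (cell_right_subset n k hy)]),
      ih _ _ hm', ih _ _ hm', ofReal_half_add (theta_nonneg hv _ _ _ _) (theta_nonneg hv _ _ _ _)]
    rfl

/-- The Cauchy-Schwarz inequality on a cell, with a weight inserted. -/
theorem sq_lintegral_cell_le {t : StepTree} (ht : t.Pos) (n k : ℕ) {g : ℝ → ℝ≥0∞}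
    (hg : AEMeasurable g) :
    (∫⁻ x in cell n k, g x) ^ 2 ≤
      (∫⁻ x in cell n k, ENNReal.ofReal (t.inv.toFun x) * g x ^ 2) *
        ∫⁻ x in cell n k, ENNReal.ofReal (t.toFun x) := by
  have hm1 : Measurable fun x => ENNReal.ofReal (√(t.inv.toFun x)) :=
    t.inv.measurable_toFun.sqrt.ennreal_ofReal
  have hm2 : Measurable fun x => ENNReal.ofReal (√(t.toFun x)) :=
    t.measurable_toFun.sqrt.ennreal_ofReal
  have h := ENNReal.lintegral_mul_le_Lp_mul_Lq (volume.restrict (cell n k))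
    Real.HolderConjugate.two_two (hm1.aemeasurable.mul hg.restrict) hm2.aemeasurable
  have e1 : ∀ x, ((fun x => ENNReal.ofReal (√(t.inv.toFun x))) * g *
      fun x => ENNReal.ofReal (√(t.toFun x))) x = g x := by
    intro x
    simp only [Pi.mul_apply]
    rw [mul_right_comm, ← ENNReal.ofReal_mul (Real.sqrt_nonneg _), ← Real.sqrt_mul
      (StepTree.toFun_pos ht.inv x).le, StepTree.toFun_inv, Pi.inv_apply,
      inv_mul_cancel₀ (StepTree.toFun_pos ht x).ne']
    simp
  have e2 : ∀ x, ((fun x => ENNReal.ofReal (√(t.inv.toFun x))) * g) x ^ (2 : ℝ) =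
      ENNReal.ofReal (t.inv.toFun x) * g x ^ 2 := by
    intro x
    rw [ENNReal.rpow_two, Pi.mul_apply, mul_pow, ← ENNReal.ofReal_pow (Real.sqrt_nonneg _),
      Real.sq_sqrt (StepTree.toFun_pos ht.inv x).le]
  have e3 : ∀ x, ENNReal.ofReal (√(t.toFun x)) ^ (2 : ℝ) = ENNReal.ofReal (t.toFun x) := by
    intro x
    rw [ENNReal.rpow_two, ← ENNReal.ofReal_pow (Real.sqrt_nonneg _),
      Real.sq_sqrt (StepTree.toFun_pos ht x).le]
  simp only [e1, e2, e3] at h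
  have h2 := pow_le_pow_left₀ zero_le h 2
  rw [mul_pow, ← ENNReal.rpow_two, ← ENNReal.rpow_two, ← ENNReal.rpow_two, ← ENNReal.rpow_mul,
    ← ENNReal.rpow_mul] at h2
  simpa using h2

/-- Sawyer's theorem for the dyadic maximal operator on `L²(w⁻¹)`, for step weights `w`. -/
theorem maximalNorm_inv_le {t : StepTree} (ht : t.Pos) {K : ℝ} (hK : 0 < K)
    (htest : ∀ n k, (t.desc n k).psi 0 ≤ K * (t.desc n k).mean) :
    maximalNorm t.inv.toFun ≤ ENNReal.ofReal √(4 * K) := by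
  refine iSup_le fun f => iSup_le fun hf => iSup_le fun hf1 => ?_
  rw [eLpNorm_le_iff_sq, lintegral_weightMeasure t.inv.measurable_toFun] at hf1 ⊢
  rw [← ENNReal.ofReal_pow (Real.sqrt_nonneg _), Real.sq_sqrt (by positivity)]
  simp only [one_pow, enorm_eq_self] at hf1 ⊢
  have hfm := aemeasurable_of_weightMeasure t.inv.measurable_toFun (StepTree.toFun_pos ht.inv) hf
  -- The norm says nothing about `f` outside `[0,1)`, hence the truncation.
  set g : ℝ → ℝ≥0∞ := (Ico (0 : ℝ) 1).indicator fun y => ‖f y‖ₑ with hg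
  have hgm : AEMeasurable g := (aemeasurable_indicator_iff measurableSet_Ico).2 hfm.enorm
  set G : ℝ → ℝ≥0∞ := fun y => ENNReal.ofReal (t.inv.toFun y) * g y ^ 2 with hG
  have hGtot : ∫⁻ y, G y ≤ 1 := by
    refine le_trans (le_of_eq ?_) hf1
    rw [← lintegral_indicator measurableSet_Ico]
    congr 1
    funext y
    by_cases hy : y ∈ Ico (0 : ℝ) 1 <;> simp [hG, hg, hy]
  have hGfin : ∀ n k, ∫⁻ y in cell n k, G y ≠ ∞ := fun n k =>
    ((setLIntegral_le_lintegral _ _).trans hGtot).trans_lt ENNReal.one_lt_top |>.ne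
  have hgfin : ∀ n k, ∫⁻ y in cell n k, g y ≠ ∞ := by
    intro n k h
    have := sq_lintegral_cell_le ht n k hgm
    rw [h, StepTree.lintegral_toFun ht] at this
    rw [ENNReal.top_pow two_ne_zero] at this
    exact (ENNReal.mul_lt_top (hGfin n k).lt_top ENNReal.ofReal_lt_top).not_ge this
  set x : ℕ → ℕ → ℝ := fun n k => 2 ^ n * (∫⁻ y in cell n k, g y).toReal with hx
  set F : ℕ → ℕ → ℝ := fun n k => 2 ^ n * (∫⁻ y in cell n k, G y).toReal with hF
  have hadd : ∀ (H : ℝ → ℝ≥0∞), (∀ n k, ∫⁻ y in cell n k, H y ≠ ∞) → ∀ n k,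
      2 ^ n * (∫⁻ y in cell n k, H y).toReal =
        (2 ^ (n + 1) * (∫⁻ y in cell (n + 1) (2 * k), H y).toReal +
          2 ^ (n + 1) * (∫⁻ y in cell (n + 1) (2 * k + 1), H y).toReal) / 2 := by
    intro H hH n k
    rw [lintegral_cell_split, ENNReal.toReal_add (hH _ _) (hH _ _), pow_succ]
    ring
  have hxF : ∀ n k, x n k ^ 2 ≤ F n k * (t.desc n k).mean := by
    intro n k
    have h := sq_lintegral_cell_le ht n k hgm
    rw [StepTree.lintegral_toFun ht] at h
    have hm := (ht.desc n k).mean_pos.le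
    have h' := ENNReal.toReal_mono (ENNReal.mul_ne_top (hGfin n k) ENNReal.ofReal_ne_top) h
    rw [ENNReal.toReal_pow, ENNReal.toReal_mul, ENNReal.toReal_ofReal (by positivity)] at h'
    simp only [hx, hF]
    have h2 : (0 : ℝ) < 2 ^ n := by positivity
    calc (2 ^ n * (∫⁻ y in cell n k, g y).toReal) ^ 2
        = (2 ^ n) ^ 2 * (∫⁻ y in cell n k, g y).toReal ^ 2 := by ring
      _ ≤ (2 ^ n) ^ 2 * ((∫⁻ y in cell n k, G y).toReal *
            (((2 : ℝ) ^ n)⁻¹ * (t.desc n k).mean)) := by gcongr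
      _ = _ := by field_simp
  -- The truncations of the maximal function to finitely many levels increase to it.
  have hle : ∀ y ∈ Ico (0 : ℝ) 1,
      maximalFn f y ≤ ⨆ N, ENNReal.ofReal (runMax x N 0 0 y) := by
    intro y hy
    refine iSup_le fun I => ?_
    by_cases hyI : y ∈ interval I
    · rw [indicator_of_mem hyI]
      refine le_trans ?_ (le_iSup _ I.1)
      rw [interval_eq_cell] at hyI
      have h1 := le_runMax x I.1 0 0 y
      rw [zero_add, (mem_cell_iff.1 hyI).2] at h1
      refine le_trans (le_of_eq ?_) (ENNReal.ofReal_le_ofReal h1)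
      have hl : 0 < ((2 : ℝ) ^ I.1)⁻¹ := by positivity
      have hgI : ∫⁻ y in cell I.1 I.2, ‖f y‖ₑ = ∫⁻ y in cell I.1 I.2, g y :=
        setLIntegral_congr_fun (measurableSet_cell _ _) fun z hz => by
          simp only [hg]
          rw [indicator_of_mem (cell_subset_Ico I.2.2 hz)]
      rw [avg, interval_eq_cell, hgI, len, ← ENNReal.ofReal_toReal (hgfin I.1 I.2),
        ← ENNReal.ofReal_div_of_pos hl]
      congr 1
      simp only [hx]
      field_simp
    · rw [indicator_of_notMem hyI]
      exact zero_le
  calc ∫⁻ y in Ico (0 : ℝ) 1, ENNReal.ofReal (t.inv.toFun y) * maximalFn f y ^ 2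
      ≤ ∫⁻ y in Ico (0 : ℝ) 1, ⨆ N, ENNReal.ofReal (t.inv.toFun y) *
          ENNReal.ofReal (runMax x N 0 0 y) ^ 2 := by
        refine setLIntegral_mono' measurableSet_Ico fun y hy => ?_
        rw [← ENNReal.mul_iSup, ← ENNReal.iSup_pow]
        gcongr
        exact hle y hy
    _ = ⨆ N, ∫⁻ y in Ico (0 : ℝ) 1, ENNReal.ofReal (t.inv.toFun y) *
          ENNReal.ofReal (runMax x N 0 0 y) ^ 2 := by
        refine lintegral_iSup (fun N => ?_) fun N N' hN y => ?_
        · exact t.inv.measurable_toFun.ennreal_ofReal.mul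
            ((measurable_runMax x N 0 measurable_const).ennreal_ofReal.pow_const 2)
        · have := runMax_mono x 0 0 y hN
          dsimp only at this ⊢
          gcongr
    _ ≤ ENNReal.ofReal (4 * K) := by
        refine iSup_le fun N => ?_
        rw [← cell_zero_zero, lintegral_runMax_sq ht.inv x N 0 0 le_rfl]
        refine ENNReal.ofReal_le_ofReal ?_
        obtain ⟨e, A, -, hA, -, h⟩ := theta_le ht hK htest (x := x) (F := F) (hadd g hgfin)
          (hadd G hGfin) hxF N 0 0 0 le_rfl
        simp only [StepTree.inv_desc]
        have hF1 : F 0 0 ≤ 1 := by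
          have := ENNReal.toReal_mono ENNReal.one_ne_top
            ((setLIntegral_le_lintegral (cell 0 0) _).trans hGtot)
          simpa [hF] using this
        have hm := (ht.desc 0 0).mean_pos
        have : 0 ≤ x 0 0 ^ 2 / ((t.desc 0 0).mean + A / K) := by positivity
        simp only [pow_zero, inv_one, one_mul]
        nlinarith

/-! ### Lower bounds for operator norms -/

theorem le_normL2 {T : (ℝ → ℝ) → ℝ → ℝ≥0∞} {μ ν : Measure ℝ} {f : ℝ → ℝ}
    (hf : AEStronglyMeasurable f μ) (hf1 : eLpNorm f 2 μ ≤ 1) :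
    eLpNorm (T f) 2 ν ≤ normL2 T μ ν :=
  le_iSup_of_le f (le_iSup_of_le hf (le_iSup_of_le hf1 le_rfl))

theorem le_normL21 {T : (ℝ → ℝ) → ℝ → ℝ≥0∞} {μ ν : Measure ℝ} {f : ℝ → ℝ}
    (hf : AEStronglyMeasurable f μ) (hf1 : lorentzNorm f μ ≤ 1) :
    eLpNorm (T f) 2 ν ≤ normL21 T μ ν :=
  le_iSup_of_le f (le_iSup_of_le hf (le_iSup_of_le hf1 le_rfl))

/-- The map `f ↦ w f` is an isometry from `L²(w)` onto `L²(w⁻¹)`. -/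
theorem normL2_squareFnW {w : ℝ → ℝ} (hw : Measurable w) (hpos : ∀ x, 0 < w x) :
    normL2 (squareFnW w) (weightMeasure w) (weightMeasure w⁻¹) = squareNorm w⁻¹ := by
  have hposi : ∀ x, 0 < w⁻¹ x := fun x => inv_pos.2 (hpos x)
  have hnorm : ∀ f : ℝ → ℝ, ∫⁻ x, ‖w x * f x‖ₑ ^ 2 ∂weightMeasure w⁻¹ =
      ∫⁻ x, ‖f x‖ₑ ^ 2 ∂weightMeasure w := by
    intro f
    rw [lintegral_weightMeasure hw, lintegral_weightMeasure hw.inv]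
    congr 1
    funext x
    have h1 : ‖w x‖ₑ = ENNReal.ofReal (w x) := Real.enorm_of_nonneg (hpos x).le
    rw [enorm_mul, mul_pow, h1, ← mul_assoc, sq (ENNReal.ofReal (w x)), ← mul_assoc, Pi.inv_apply,
      ← ENNReal.ofReal_mul (inv_pos.2 (hpos x)).le, inv_mul_cancel₀ (hpos x).ne',
      ENNReal.ofReal_one, one_mul]
  have hac : weightMeasure w⁻¹ ≪ volume.restrict (Ico (0 : ℝ) 1) :=
    withDensity_absolutelyContinuous _ _
  have hac' : weightMeasure w ≪ volume.restrict (Ico (0 : ℝ) 1) :=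
    withDensity_absolutelyContinuous _ _
  refine le_antisymm ?_ ?_
  · refine iSup_le fun f => iSup_le fun hf => iSup_le fun hf1 => ?_
    refine le_normL2 (T := squareFn) (f := fun x => w x * f x) ?_ ?_
    · exact hw.aestronglyMeasurable.mul
        ((aemeasurable_of_weightMeasure hw hpos hf).aestronglyMeasurable.mono_ac hac)
    · rw [eLpNorm_le_iff_sq] at hf1 ⊢
      rwa [hnorm]
  · refine iSup_le fun f => iSup_le fun hf => iSup_le fun hf1 => ?_
    have e : ∀ x, w x * (w⁻¹ x * f x) = f x := by
      intro x
      rw [← mul_assoc, Pi.inv_apply, mul_inv_cancel₀ (hpos x).ne', one_mul]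
    have := le_normL2 (T := squareFnW w) (μ := weightMeasure w) (ν := weightMeasure w⁻¹)
      (f := fun x => w⁻¹ x * f x) ?_ ?_
    · simpa only [squareFnW, e] using this
    · exact hw.inv.aestronglyMeasurable.mul
        ((aemeasurable_of_weightMeasure hw.inv hposi hf).aestronglyMeasurable.mono_ac hac')
    · rw [eLpNorm_le_iff_sq] at hf1 ⊢
      rw [← hnorm]
      simpa only [e] using hf1

/-- The necessity of the `A₂` condition: the norm of `M` on `L²(w⁻¹)` is tested on the functions
`w χ_I`. -/
theorem a2Char_le_maximalNorm_sq {t : StepTree} (ht : t.Pos) :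
    a2Char t.toFun ≤ maximalNorm t.inv.toFun ^ 2 := by
  rw [StepTree.a2Char_toFun ht]
  refine iSup_le fun I => ?_
  set s := t.desc I.1 I.2 with hs
  have hm : 0 < s.mean := (ht.desc _ _).mean_pos
  have hv : 0 < s.inv.mean := (ht.desc _ _).inv.mean_pos
  have hl : 0 < ((2 : ℝ) ^ I.1)⁻¹ := by positivity
  set c : ℝ := (√(((2 : ℝ) ^ I.1)⁻¹ * s.mean))⁻¹ with hc
  have hc0 : 0 ≤ c := by positivity
  have hc2 : c ^ 2 * (((2 : ℝ) ^ I.1)⁻¹ * s.mean) = 1 := by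
    rw [hc, inv_pow, Real.sq_sqrt (by positivity)]
    exact inv_mul_cancel₀ (by positivity)
  have hsub : cell I.1 I.2 ⊆ Ico 0 1 := cell_subset_Ico I.2.2
  set f : ℝ → ℝ := (cell I.1 I.2).indicator fun y => c * t.toFun y with hf
  have hfm : Measurable f := (t.measurable_toFun.const_mul c).indicator (measurableSet_cell _ _)
  have hfc : ∀ y ∈ cell I.1 I.2, ‖f y‖ₑ = ENNReal.ofReal c * ENNReal.ofReal (t.toFun y) := by
    intro y hy
    rw [hf, indicator_of_mem hy, enorm_mul, Real.enorm_of_nonneg hc0,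
      Real.enorm_of_nonneg (StepTree.toFun_pos ht y).le]
  have hf1 : eLpNorm f 2 (weightMeasure t.inv.toFun) ≤ 1 := by
    rw [eLpNorm_le_iff_sq, lintegral_weightMeasure t.inv.measurable_toFun]
    have : ∀ y, ENNReal.ofReal (t.inv.toFun y) * ‖f y‖ₑ ^ 2 =
        (cell I.1 I.2).indicator (fun y => ENNReal.ofReal (c ^ 2) * ENNReal.ofReal (t.toFun y))
          y := by
      intro y
      by_cases hy : y ∈ cell I.1 I.2
      · have hp := StepTree.toFun_pos ht y
        rw [indicator_of_mem hy, hfc y hy, StepTree.toFun_inv, Pi.inv_apply,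
          ← ENNReal.ofReal_mul hc0, ← ENNReal.ofReal_pow (by positivity),
          ← ENNReal.ofReal_mul (by positivity), ← ENNReal.ofReal_mul (by positivity)]
        congr 1
        field_simp
      · simp [hf, hy]
    simp only [this]
    rw [setLIntegral_indicator (measurableSet_cell _ _), inter_eq_left.2 hsub,
      lintegral_const_mul _ t.measurable_toFun.ennreal_ofReal, StepTree.lintegral_toFun ht,
      ← ENNReal.ofReal_mul (by positivity), hc2]
    simp
  refine le_trans ?_ (pow_le_pow_left₀ zero_le
    (le_normL2 (T := maximalFn) hfm.aestronglyMeasurable hf1) 2)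
  rw [eLpNorm_two_sq, lintegral_weightMeasure t.inv.measurable_toFun]
  have hM : ∀ y ∈ cell I.1 I.2, ENNReal.ofReal (c * s.mean) ≤ maximalFn f y := by
    intro y hy
    refine le_iSup_of_le I ?_
    rw [interval_eq_cell, indicator_of_mem hy, avg, interval_eq_cell,
      setLIntegral_congr_fun (measurableSet_cell _ _) hfc,
      lintegral_const_mul _ t.measurable_toFun.ennreal_ofReal, StepTree.lintegral_toFun ht,
      ← ENNReal.ofReal_mul hc0, len, ← ENNReal.ofReal_div_of_pos hl, ← hs]
    refine ENNReal.ofReal_le_ofReal (le_of_eq ?_)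
    field_simp
  calc ENNReal.ofReal (s.mean * s.inv.mean)
      = ∫⁻ y in cell I.1 I.2,
          ENNReal.ofReal (t.inv.toFun y) * ENNReal.ofReal (c * s.mean) ^ 2 := by
        rw [lintegral_mul_const _ t.inv.measurable_toFun.ennreal_ofReal,
          StepTree.lintegral_toFun ht.inv, StepTree.inv_desc, ← hs,
          ← ENNReal.ofReal_pow (by positivity), ← ENNReal.ofReal_mul (by positivity)]
        congr 1
        linear_combination (-(s.mean * s.inv.mean)) * hc2
    _ ≤ ∫⁻ y in cell I.1 I.2, ENNReal.ofReal (t.inv.toFun y) * ‖maximalFn f y‖ₑ ^ 2 := by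
        refine setLIntegral_mono' (measurableSet_cell _ _) fun y hy => ?_
        rw [enorm_eq_self]
        gcongr
        exact hM y hy
    _ ≤ _ := lintegral_mono_set hsub

/-- The contribution of the dyadic interval `(n, k)` to `∫ (S w)² w⁻¹`. -/
noncomputable def sqTerm (t : StepTree) (n k : ℕ) : ℝ :=
  ((2 : ℝ) ^ n)⁻¹ * ((((t.desc n k).right.mean - (t.desc n k).left.mean) / 2) ^ 2 *
    (t.desc n k).inv.mean)

theorem sqTerm_nonneg {t : StepTree} (ht : t.Pos) (n k : ℕ) : 0 ≤ sqTerm t n k := by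
  have := (ht.desc n k).inv.mean_pos
  unfold sqTerm
  positivity

/-- The sum of the contributions of all dyadic subintervals of `(n, k)` is given by the recursion
that defines `sq`; `i` levels suffice when the subtree over `(n, k)` has height at most `i`. -/
theorem sum_sqTerm (t : StepTree) (i n k : ℕ) (h : (t.desc n k).depth ≤ i) :
    ∑ j ∈ Finset.range i, ∑ l ∈ Finset.range (2 ^ j), sqTerm t (n + j) (k * 2 ^ j + l) =
      ((2 : ℝ) ^ n)⁻¹ * (t.desc n k).sq := by
  induction i generalizing n k with
  | zero =>
    cases hs : t.desc n k with
    | leaf c => simp [StepTree.sq]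
    | node l r =>
      rw [hs] at h
      simp [StepTree.depth] at h
  | succ i ih =>
    have hl : (t.desc n k).left.depth ≤ i := by
      cases hs : t.desc n k with
      | leaf c => simp [StepTree.left, StepTree.depth]
      | node l r =>
        rw [hs] at h
        simp only [StepTree.depth] at h
        simp only [StepTree.left]
        omega
    have hr : (t.desc n k).right.depth ≤ i := by
      cases hs : t.desc n k with
      | leaf c => simp [StepTree.right, StepTree.depth]
      | node l r =>
        rw [hs] at h
        simp only [StepTree.depth] at h
        simp only [StepTree.right]
        omega
    have h1 := ih (n + 1) (2 * k) (by rwa [StepTree.desc_two_mul])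
    have h2 := ih (n + 1) (2 * k + 1) (by rwa [StepTree.desc_two_mul_add_one])
    rw [StepTree.desc_two_mul] at h1
    rw [StepTree.desc_two_mul_add_one] at h2
    have hsplit : ∀ j, ∑ l ∈ Finset.range (2 ^ (j + 1)),
        sqTerm t (n + (j + 1)) (k * 2 ^ (j + 1) + l) =
        (∑ l ∈ Finset.range (2 ^ j), sqTerm t (n + 1 + j) (2 * k * 2 ^ j + l)) +
        ∑ l ∈ Finset.range (2 ^ j), sqTerm t (n + 1 + j) ((2 * k + 1) * 2 ^ j + l) := by
      intro j
      rw [show 2 ^ (j + 1) = 2 ^ j + 2 ^ j by ring, Finset.sum_range_add]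
      congr 1 <;> refine Finset.sum_congr rfl fun l _ => ?_ <;> congr 1 <;> ring
    rw [Finset.sum_range_succ', Finset.sum_congr rfl fun j _ => hsplit j, Finset.sum_add_distrib,
      h1, h2, (t.desc n k).sq_eq]
    simp only [add_zero, pow_zero, mul_one, Finset.range_one, Finset.sum_singleton, sqTerm]
    rw [pow_succ]
    field_simp
    ring

theorem integrableOn_toFun {t : StepTree} (ht : t.Pos) (n k : ℕ) :
    IntegrableOn t.toFun (cell n k) := by
  refine ⟨t.measurable_toFun.aestronglyMeasurable, ?_⟩
  rw [hasFiniteIntegral_iff_ofReal (ae_of_all _ fun x => (StepTree.toFun_pos ht x).le),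
    StepTree.lintegral_toFun ht]
  exact ENNReal.ofReal_lt_top

theorem integral_toFun {t : StepTree} (ht : t.Pos) (n k : ℕ) :
    ∫ x in cell n k, t.toFun x = ((2 : ℝ) ^ n)⁻¹ * (t.desc n k).mean := by
  have := (ht.desc n k).mean_pos
  rw [integral_eq_lintegral_of_nonneg_ae (ae_of_all _ fun x => (StepTree.toFun_pos ht x).le)
    t.measurable_toFun.aestronglyMeasurable, StepTree.lintegral_toFun ht,
    ENNReal.toReal_ofReal (by positivity)]

theorem leftHalf_eq_cell (I : DyadicIndex) : leftHalf I = cell (I.1 + 1) (2 * (I.2 : ℕ)) := by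
  simp only [leftHalf, cell, lo, len, pow_succ, mul_inv]
  push_cast
  congr 1 <;> ring

theorem rightHalf_eq_cell (I : DyadicIndex) :
    rightHalf I = cell (I.1 + 1) (2 * (I.2 : ℕ) + 1) := by
  simp only [rightHalf, cell, lo, len, pow_succ, mul_inv]
  push_cast
  congr 1 <;> ring

theorem integral_mul_haar {t : StepTree} (ht : t.Pos) (c : ℝ) (I : DyadicIndex) :
    ∫ y, t.toFun y * c * haar I y = c * (√(len I))⁻¹ * (len I *
      (((t.desc I.1 I.2).right.mean - (t.desc I.1 I.2).left.mean) / 2)) := by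
  have e : ∀ y, t.toFun y * c * haar I y = c * (√(len I))⁻¹ *
      ((cell (I.1 + 1) (2 * (I.2 : ℕ) + 1)).indicator t.toFun y -
        (cell (I.1 + 1) (2 * (I.2 : ℕ))).indicator t.toFun y) := by
    intro y
    rw [haar, leftHalf_eq_cell, rightHalf_eq_cell]
    simp only [indicator]
    split_ifs <;> ring
  simp only [e]
  rw [integral_const_mul, integral_sub
      ((integrable_indicator_iff (measurableSet_cell _ _)).2 (integrableOn_toFun ht _ _))
      ((integrable_indicator_iff (measurableSet_cell _ _)).2 (integrableOn_toFun ht _ _)),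
    integral_indicator (measurableSet_cell _ _), integral_indicator (measurableSet_cell _ _),
    integral_toFun ht, integral_toFun ht, StepTree.desc_two_mul, StepTree.desc_two_mul_add_one,
    len, pow_succ, mul_inv]
  ring

/-- The norm of `S (c w)` in `L²(w⁻¹)`, for a constant `c`. -/
theorem le_eLpNorm_squareFnW {t : StepTree} (ht : t.Pos) (c : ℝ) :
    ENNReal.ofReal (c ^ 2 * t.sq) ≤
      eLpNorm (squareFnW t.toFun fun _ => c) 2 (weightMeasure t.inv.toFun) ^ 2 := by
  rw [eLpNorm_two_sq, lintegral_weightMeasure t.inv.measurable_toFun]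
  have hsqfn : ∀ y, ‖squareFnW t.toFun (fun _ => c) y‖ₑ ^ 2 = ∑' I : DyadicIndex,
      (interval I).indicator (fun _ => ENNReal.ofReal
        ((∫ y, t.toFun y * c * haar I y) ^ 2 / len I)) y := by
    intro y
    rw [enorm_eq_self, squareFnW, squareFn, ← ENNReal.rpow_two, ← ENNReal.rpow_mul]
    norm_num
  have hmeas : ∀ I : DyadicIndex, Measurable fun y => ENNReal.ofReal (t.inv.toFun y) *
      (interval I).indicator (fun _ => ENNReal.ofReal
        ((∫ y, t.toFun y * c * haar I y) ^ 2 / len I)) y := fun I =>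
    t.inv.measurable_toFun.ennreal_ofReal.mul (measurable_const.indicator measurableSet_Ico)
  have hterm : ∀ I : DyadicIndex, ∫⁻ y in Ico (0 : ℝ) 1, ENNReal.ofReal (t.inv.toFun y) *
      (interval I).indicator (fun _ => ENNReal.ofReal
        ((∫ y, t.toFun y * c * haar I y) ^ 2 / len I)) y =
      ENNReal.ofReal (c ^ 2 * sqTerm t I.1 I.2) := by
    intro I
    have hl : 0 < len I := by rw [len]; positivity
    have hv := (ht.desc I.1 I.2).inv.mean_pos
    simp only [interval_eq_cell]
    have e : ∀ y, ENNReal.ofReal (t.inv.toFun y) * (cell I.1 I.2).indicator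
        (fun _ => ENNReal.ofReal ((∫ y, t.toFun y * c * haar I y) ^ 2 / len I)) y =
        (cell I.1 I.2).indicator (fun y => ENNReal.ofReal (t.inv.toFun y) *
          ENNReal.ofReal ((∫ y, t.toFun y * c * haar I y) ^ 2 / len I)) y := by
      intro y
      by_cases hy : y ∈ cell I.1 I.2 <;> simp [hy]
    simp only [e]
    rw [setLIntegral_indicator (measurableSet_cell _ _), inter_eq_left.2 (cell_subset_Ico I.2.2),
      lintegral_mul_const _ t.inv.measurable_toFun.ennreal_ofReal,
      StepTree.lintegral_toFun ht.inv, StepTree.inv_desc,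
      ← ENNReal.ofReal_mul (by positivity), integral_mul_haar ht]
    congr 1
    rw [sqTerm, mul_pow, mul_pow, inv_pow, Real.sq_sqrt hl.le, ← len]
    field_simp
  simp only [hsqfn, ← ENNReal.tsum_mul_left]
  rw [lintegral_tsum fun I => (hmeas I).aemeasurable]
  simp only [hterm]
  rw [ENNReal.tsum_sigma' (f := fun I : DyadicIndex => ENNReal.ofReal (c ^ 2 * sqTerm t I.1 I.2))]
  refine le_trans (le_of_eq ?_) (ENNReal.sum_le_tsum (Finset.range t.depth))
  have h0 := sum_sqTerm t t.depth 0 0 le_rfl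
  simp only [zero_add, zero_mul, pow_zero, inv_one, one_mul] at h0
  have hnn : ∀ n k, 0 ≤ c ^ 2 * sqTerm t n k := fun n k =>
    mul_nonneg (sq_nonneg c) (sqTerm_nonneg ht n k)
  have e0 : t.desc 0 0 = t := rfl
  rw [e0] at h0
  rw [← h0, Finset.mul_sum, ENNReal.ofReal_sum_of_nonneg fun n _ =>
    mul_nonneg (sq_nonneg c) (Finset.sum_nonneg fun k _ => sqTerm_nonneg ht n k)]
  refine Finset.sum_congr rfl fun n _ => ?_
  rw [Finset.mul_sum, ENNReal.ofReal_sum_of_nonneg fun k _ => hnn n k, tsum_fintype,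
    Finset.sum_range]

theorem weightMeasure_univ {t : StepTree} (ht : t.Pos) :
    weightMeasure t.toFun univ = ENNReal.ofReal t.mean := by
  rw [← lintegral_one, lintegral_weightMeasure t.measurable_toFun, ← cell_zero_zero]
  simp only [mul_one]
  rw [StepTree.lintegral_toFun ht]
  simp [StepTree.desc]

/-- A constant function has the same norm in `L^{2,1}(μ)` as in `L²(μ)`. -/
theorem lorentzNorm_const (μ : Measure ℝ) {c : ℝ} (hc : 0 ≤ c) :
    lorentzNorm (fun _ => c) μ = ENNReal.ofReal c * μ univ ^ (1 / 2 : ℝ) := by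
  have : ∀ s : ℝ, μ {_x : ℝ | s < |c|} ^ (1 / 2 : ℝ) =
      (Iio c).indicator (fun _ => μ univ ^ (1 / 2 : ℝ)) s := by
    intro s
    rw [abs_of_nonneg hc]
    by_cases hs : s < c <;> simp [hs]
  rw [lorentzNorm]
  simp only [this]
  rw [setLIntegral_indicator measurableSet_Iio, setLIntegral_const, inter_comm, Ioi_inter_Iio,
    Real.volume_Ioo, sub_zero, mul_comm]

/-- Testing the square function on a constant function. -/
theorem le_norms_squareFnW {t : StepTree} (ht : t.Pos) :
    ENNReal.ofReal √(t.sq / t.mean) ≤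
        normL2 (squareFnW t.toFun) (weightMeasure t.toFun) (weightMeasure t.inv.toFun) ∧
      ENNReal.ofReal √(t.sq / t.mean) ≤
        normL21 (squareFnW t.toFun) (weightMeasure t.toFun) (weightMeasure t.inv.toFun) := by
  have hm := ht.mean_pos
  set c : ℝ := (√t.mean)⁻¹ with hc
  have hc0 : 0 ≤ c := by positivity
  have hc2 : c ^ 2 = t.mean⁻¹ := by rw [hc, inv_pow, Real.sq_sqrt hm.le]
  have key : ENNReal.ofReal √(t.sq / t.mean) ≤
      eLpNorm (squareFnW t.toFun fun _ => c) 2 (weightMeasure t.inv.toFun) := by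
    have h := le_eLpNorm_squareFnW ht c
    rw [hc2, inv_mul_eq_div] at h
    rcases le_total 0 (t.sq / t.mean) with h0 | h0
    · rw [← (ENNReal.pow_right_strictMono two_ne_zero).le_iff_le]
      simpa only [← ENNReal.ofReal_pow (Real.sqrt_nonneg _), Real.sq_sqrt h0] using h
    · simp [Real.sqrt_eq_zero_of_nonpos h0]
  refine ⟨key.trans (le_normL2 (T := squareFnW t.toFun) aestronglyMeasurable_const ?_),
    key.trans (le_normL21 (T := squareFnW t.toFun) aestronglyMeasurable_const ?_)⟩
  · rw [eLpNorm_le_iff_sq, lintegral_const, weightMeasure_univ ht, Real.enorm_of_nonneg hc0,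
      ← ENNReal.ofReal_pow hc0, hc2, ← ENNReal.ofReal_mul (by positivity),
      inv_mul_cancel₀ hm.ne']
    simp
  · rw [lorentzNorm_const _ hc0, weightMeasure_univ ht, ENNReal.ofReal_rpow_of_pos hm,
      ← ENNReal.ofReal_mul hc0, ← Real.sqrt_eq_rpow, hc, inv_mul_cancel₀ (by positivity)]
    simp

namespace StepTree

/-! ### Carleson sums and the building blocks of the weights -/

theorem sq_nonneg_of_pos {t : StepTree} (h : t.Pos) : 0 ≤ t.sq := by
  induction t with
  | leaf c => exact le_rfl
  | node l r hl hr =>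
    have := hl h.1
    have := hr h.2
    have := h.1.inv.mean_pos
    have := h.2.inv.mean_pos
    simp only [sq]
    positivity

theorem le_sq_node {l r : StepTree} (hl : l.Pos) (hr : r.Pos) :
    (l.sq + r.sq) / 2 ≤ (node l r).sq := by
  have h1 : 0 < (node l r).inv.mean := Pos.mean_pos (Pos.inv ⟨hl, hr⟩)
  have := mul_nonneg (sq_nonneg ((r.mean - l.mean) / 2)) h1.le
  rw [sq_eq (node l r)]
  simp only [left, right]
  linarith

theorem psi_leaf_zero {c : ℝ} (hc : 0 < c) : (leaf c).psi 0 = c := by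
  simp only [psi, max_eq_right hc.le]
  rw [pow_two, mul_self_div_self]

/-- The Carleson sum `|I|⁻¹ ∑ |J| ⟨w⟩_J² ⟨w⁻¹⟩_J` over the dyadic subintervals `J` of `I` (with the
intervals on which `w` is constant counted once): a crude majorant for the testing
quantity `psi w 0`. -/
noncomputable def carl : StepTree → ℝ
  | leaf c => c
  | node l r => (node l r).mean ^ 2 * (node l r).inv.mean + (carl l + carl r) / 2

theorem psi_node_le {l r : StepTree} (hl : l.Pos) (hr : r.Pos) :
    (node l r).psi 0 ≤
      (node l r).mean ^ 2 * (node l r).inv.mean + (l.psi 0 + r.psi 0) / 2 := by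
  have hm : 0 ≤ (node l r).mean := (show (node l r).Pos from ⟨hl, hr⟩).mean_pos.le
  have h1 := psi_le_add hl hm
  have h2 := psi_le_add hr hm
  rw [psi_eq, max_eq_right hm]
  simp only [left, right]
  simp only [inv, mean] at h1 h2 ⊢
  linarith

theorem psi_le_carl {t : StepTree} (h : t.Pos) : t.psi 0 ≤ t.carl := by
  induction t with
  | leaf c =>
    have hc : 0 < c := h
    exact (psi_leaf_zero hc).le
  | node l r hl hr =>
    have h1 := hl h.1
    have h2 := hr h.2
    refine (psi_node_le h.1 h.2).trans ?_
    simp only [carl]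
    linarith

/-- A weight with two values, with average `a` and with reciprocal of average `P / a`. -/
noncomputable def twoVal (P a : ℝ) : StepTree :=
  node (leaf (a * (1 + √(1 - P⁻¹)))) (leaf (a * (1 - √(1 - P⁻¹))))

/-- A weight with average `b` and with reciprocal of average `ε / b`, for a family `G` of weights
with averages `b` and reciprocals of averages `(2 ε - 1) / b`: as for a power weight, the average
of `w` nearly doubles on one of the halves, while that of `w⁻¹` is the same on both. -/
noncomputable def branch (ε : ℝ) (G : ℝ → StepTree) (b : ℝ) : StepTree :=
  node (G ((2 - 1 / ε) * b)) (leaf (b / ε))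

/-- A weight of average `a`. On a nested sequence of `2 j` dyadic intervals its averages alternate
between `a` and `5 a / 4`, while the averages of the reciprocal grow geometrically; the halves left
out at each step carry copies of `branch`, the last interval carries `twoVal`. -/
noncomputable def chain (ε P : ℝ) (G : ℝ → StepTree) : ℕ → ℝ → StepTree
  | 0, a => twoVal P a
  | j + 1, a =>
    node (node (chain ε P G j a) (branch ε G (3 / 2 * a))) (branch ε G (3 / 4 * a))

/-- The iteration of `chain`. The average is `a`, that of the reciprocal is `(2 ε - 1) / a`. -/
noncomputable def tower (ε P : ℝ) (T : ℕ) : ℕ → ℝ → StepTree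
  | 0, a => twoVal (2 * ε - 1) a
  | N + 1, a => chain ε P (tower ε P T N) T a

/-- A family of weights `G b` with averages `b` and reciprocals of averages `q / b`. -/
structure Family (q : ℝ) (G : ℝ → StepTree) : Prop where
  pos : ∀ b, 0 < b → (G b).Pos
  mean : ∀ b, 0 < b → (G b).mean = b
  inv_mean : ∀ b, 0 < b → (G b).inv.mean = q / b

/-- The average of the reciprocal of `chain ε P G j 1`. -/
noncomputable def chainProd (ε P : ℝ) : ℕ → ℝ
  | 0 => P
  | j + 1 => 5 / 6 * ε + chainProd ε P j / 4

theorem chainProd_pos {ε P : ℝ} (hε : 0 < ε) (hP : 0 < P) (j : ℕ) : 0 < chainProd ε P j := by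
  induction j with
  | zero => exact hP
  | succ j ih => simp only [chainProd]; positivity

theorem sqrt_one_sub_inv {P : ℝ} (hP : 1 ≤ P) :
    0 ≤ √(1 - P⁻¹) ∧ √(1 - P⁻¹) < 1 ∧ (1 - √(1 - P⁻¹)) * (1 + √(1 - P⁻¹)) * P = 1 := by
  have h1 : 0 < P⁻¹ := by positivity
  have h2 : P⁻¹ ≤ 1 := inv_le_one_of_one_le₀ hP
  have h3 := Real.sq_sqrt (sub_nonneg.2 h2)
  refine ⟨Real.sqrt_nonneg _, ?_, ?_⟩
  · rw [Real.sqrt_lt' one_pos]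
    linarith
  · rw [show (1 - √(1 - P⁻¹)) * (1 + √(1 - P⁻¹)) = 1 - √(1 - P⁻¹) ^ 2 by ring, h3,
      sub_sub_cancel, inv_mul_cancel₀ (by positivity)]

theorem family_twoVal {P : ℝ} (hP : 1 ≤ P) : Family P (twoVal P) := by
  obtain ⟨h0, h1, h2⟩ := sqrt_one_sub_inv hP
  have h3 : 0 < 1 - √(1 - P⁻¹) := by linarith
  refine ⟨fun b hb => ⟨?_, ?_⟩, fun b hb => ?_, fun b hb => ?_⟩
  · show 0 < b * _
    positivity
  · show 0 < b * _
    positivity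
  · simp only [twoVal, StepTree.mean]
    ring
  · simp only [twoVal, StepTree.mean, inv]
    have : P = ((1 - √(1 - P⁻¹)) * (1 + √(1 - P⁻¹)))⁻¹ := eq_inv_of_mul_eq_one_right h2
    generalize √(1 - P⁻¹) = r at *
    rw [this]
    have : 0 < 1 + r := by linarith
    field_simp
    ring

theorem le_growth {ε : ℝ} (hε : 3 ≤ ε) : 5 / 3 ≤ 2 - 1 / ε := by
  have h1 : 1 / ε ≤ 1 / 3 := one_div_le_one_div_of_le (by norm_num) hε
  linarith

theorem family_branch {ε : ℝ} {G : ℝ → StepTree} (hε : 3 ≤ ε) (hG : Family (2 * ε - 1) G) :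
    Family ε (branch ε G) := by
  have hg := le_growth hε
  have hg0 : 0 < 2 - 1 / ε := by linarith
  refine ⟨fun b hb => ⟨hG.pos _ (by positivity), ?_⟩, fun b hb => ?_, fun b hb => ?_⟩
  · show 0 < b / ε
    positivity
  · simp only [branch, StepTree.mean, hG.mean _ (mul_pos hg0 hb)]
    field_simp
    ring
  · simp only [branch, StepTree.mean, inv, hG.inv_mean _ (mul_pos hg0 hb)]
    have h2 : (2 * ε - 1) / ((2 - 1 / ε) * b) = ε / b := by
      rw [div_eq_div_iff (by positivity) (by positivity)]
      field_simp
    rw [h2, inv_div]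
    ring

theorem family_chain {ε P : ℝ} {G : ℝ → StepTree} (hε : 3 ≤ ε) (hP : 1 ≤ P)
    (hG : Family (2 * ε - 1) G) (j : ℕ) : Family (chainProd ε P j) (chain ε P G j) := by
  induction j with
  | zero => exact family_twoVal hP
  | succ j ih =>
    have hB := family_branch hε hG
    refine ⟨fun a ha => ⟨⟨ih.pos a ha, hB.pos _ (by positivity)⟩, hB.pos _ (by positivity)⟩,
      fun a ha => ?_, fun a ha => ?_⟩
    · simp only [chain, StepTree.mean, ih.mean a ha, hB.mean _ (show 0 < 3 / 2 * a by positivity),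
        hB.mean _ (show 0 < 3 / 4 * a by positivity)]
      ring
    · simp only [chain, StepTree.mean, inv, ih.inv_mean a ha, chainProd,
        hB.inv_mean _ (show 0 < 3 / 2 * a by positivity),
        hB.inv_mean _ (show 0 < 3 / 4 * a by positivity)]
      field_simp
      ring

/-- The averages over the second interval of the chain. -/
theorem chain_mid {ε P : ℝ} {G : ℝ → StepTree} (hε : 3 ≤ ε) (hP : 1 ≤ P)
    (hG : Family (2 * ε - 1) G) (j : ℕ) {a : ℝ} (ha : 0 < a) :
    (node (chain ε P G j a) (branch ε G (3 / 2 * a))).Pos ∧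
    (node (chain ε P G j a) (branch ε G (3 / 2 * a))).mean = 5 / 4 * a ∧
    (node (chain ε P G j a) (branch ε G (3 / 2 * a))).inv.mean =
      (ε / 3 + chainProd ε P j / 2) / a := by
  have hB := family_branch hε hG
  have hC := family_chain hε hP hG j
  have h0 : 0 < 3 / 2 * a := by positivity
  refine ⟨⟨hC.pos a ha, hB.pos _ h0⟩, ?_, ?_⟩
  · simp only [mean, hC.mean a ha, hB.mean _ h0]
    ring
  · simp only [inv, mean, hC.inv_mean a ha, hB.inv_mean _ h0]
    field_simp
    ring

/-! ### Estimates for the building blocks -/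

theorem psi_twoVal_le {P a m : ℝ} (hP : 1 ≤ P) (ha : 0 < a) (hm : m ≤ 2 * a) :
    (twoVal P a).psi m ≤ 4 * P * a := by
  obtain ⟨h0, h1, h2⟩ := sqrt_one_sub_inv hP
  have hmean : (twoVal P a).inv.mean = P / a := (family_twoVal hP).inv_mean a ha
  simp only [twoVal, inv, StepTree.mean] at hmean
  simp only [twoVal, psi, StepTree.mean]
  generalize √(1 - P⁻¹) = r at *
  have hM : 0 ≤ max m ((a * (1 + r) + a * (1 - r)) / 2) ∧
      max m ((a * (1 + r) + a * (1 - r)) / 2) ≤ 2 * a := by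
    constructor
    · refine le_max_of_le_right ?_
      linarith
    · exact max_le hm (by linarith)
  generalize max m ((a * (1 + r) + a * (1 - r)) / 2) = M at *
  have hb1 : max M (a * (1 + r)) ^ 2 ≤ (2 * a) ^ 2 :=
    pow_le_pow_left₀ (le_max_of_le_left hM.1) (max_le hM.2 (by nlinarith)) 2
  have hb2 : max M (a * (1 - r)) ^ 2 ≤ (2 * a) ^ 2 :=
    pow_le_pow_left₀ (le_max_of_le_left hM.1) (max_le hM.2 (by nlinarith)) 2
  have hr1 : 0 < a * (1 + r) := by have : 0 < 1 + r := by linarith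
                                   positivity
  have hr2 : 0 < a * (1 - r) := by have : 0 < 1 - r := by linarith
                                   positivity
  calc (max M (a * (1 + r)) ^ 2 / (a * (1 + r)) + max M (a * (1 - r)) ^ 2 / (a * (1 - r))) / 2
      ≤ ((2 * a) ^ 2 / (a * (1 + r)) + (2 * a) ^ 2 / (a * (1 - r))) / 2 := by gcongr
    _ = (2 * a) ^ 2 * (((a * (1 + r))⁻¹ + (a * (1 - r))⁻¹) / 2) := by ring
    _ = 4 * P * a := by
        rw [hmean]
        field_simp
        ring

/-- The next cell has average at least `5 b / 3`, so that a floor up to this size does not raise its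
testing integral; the leaf costs `2 ε b`. -/
theorem psi_branch_le {ε K b m : ℝ} {G : ℝ → StepTree} (hε : 3 ≤ ε)
    (hψ : ∀ b m, 0 < b → m ≤ 5 / 4 * b → (G b).psi m ≤ K * b)
    (hG : Family (2 * ε - 1) G) (hb : 0 < b) (hm : m ≤ 5 / 3 * b) :
    (branch ε G b).psi m ≤ ((1 - 1 / (2 * ε)) * K + 2 * ε) * b := by
  have hg := le_growth hε
  have hg0 : 0 < 2 - 1 / ε := by linarith
  have hmean : (branch ε G b).mean = b := (family_branch hε hG).mean b hb
  rw [psi_eq, hmean]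
  have hM : 0 ≤ max m b ∧ max m b ≤ 5 / 3 * b :=
    ⟨le_max_of_le_right hb.le, max_le hm (by linarith)⟩
  generalize max m b = M at *
  simp only [branch, left, right, psi]
  have h1 := hψ ((2 - 1 / ε) * b) M (by positivity) (by nlinarith)
  have hbε : b / ε ≤ b := div_le_self hb.le (by linarith)
  have h2 : max M (b / ε) ^ 2 / (b / ε) ≤ (5 / 3 * b) ^ 2 / (b / ε) := by
    have h : max M (b / ε) ≤ 5 / 3 * b := max_le hM.2 (by linarith)
    have h' : 0 ≤ max M (b / ε) := le_max_of_le_left hM.1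
    gcongr
  have h3 : (5 / 3 * b) ^ 2 / (b / ε) ≤ 4 * ε * b := by
    rw [div_div_eq_mul_div, div_le_iff₀ hb]
    have : 0 ≤ b ^ 2 * ε := by positivity
    nlinarith
  have h4 : ((1 - 1 / (2 * ε)) * K + 2 * ε) * b =
      (K * ((2 - 1 / ε) * b) + 4 * ε * b) / 2 := by
    field_simp
    ring
  rw [h4]
  linarith

/-- Along the chain the maximal function of the weight does not grow, so its length does not
enter the bound. -/
theorem psi_chain_le {ε P B a m : ℝ} {G : ℝ → StepTree} (hε : 3 ≤ ε) (hP : 1 ≤ P)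
    (hG : Family (2 * ε - 1) G)
    (hB : ∀ b m, 0 < b → m ≤ 5 / 3 * b → (branch ε G b).psi m ≤ B * b) (j : ℕ) (ha : 0 < a)
    (hm : m ≤ 5 / 4 * a) :
    (chain ε P G j a).psi m ≤ ((1 - (1 / 4) ^ j) * B + (1 / 4) ^ j * (4 * P)) * a := by
  induction j generalizing m with
  | zero =>
    have := psi_twoVal_le hP ha (show m ≤ 2 * a by linarith)
    simpa [chain] using this
  | succ j ih =>
    have hmean : (chain ε P G (j + 1) a).mean = a := (family_chain hε hP hG (j + 1)).mean a ha
    have hmid := (chain_mid hε hP hG j ha).2.1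
    rw [psi_eq, hmean]
    have hM : max m a ≤ 5 / 4 * a := max_le hm (by linarith)
    generalize max m a = M at *
    simp only [chain, left, right]
    rw [psi_eq, hmid, max_eq_right hM]
    simp only [left, right]
    have h1 := ih (m := 5 / 4 * a) le_rfl
    have h2 := hB (3 / 2 * a) (5 / 4 * a) (by positivity) (by linarith)
    have h3 := hB (3 / 4 * a) M (by positivity) (by linarith)
    rw [pow_succ]
    linarith

theorem all_psi_twoVal {P K a : ℝ} (hP : 1 ≤ P) (hK : 4 * P ≤ K) (ha : 0 < a) :
    All (fun s => s.psi 0 ≤ K * s.mean) (twoVal P a) := by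
  have hf := family_twoVal hP
  have hpos := hf.pos a ha
  refine ⟨?_, ?_, ?_⟩
  · change (twoVal P a).psi 0 ≤ K * (twoVal P a).mean
    rw [hf.mean a ha]
    exact (psi_twoVal_le hP ha (by positivity)).trans (by gcongr)
  · have : 0 < a * (1 + √(1 - P⁻¹)) := hpos.1
    simp only [All, psi_leaf_zero this, StepTree.mean]
    nlinarith
  · have : 0 < a * (1 - √(1 - P⁻¹)) := hpos.2
    simp only [All, psi_leaf_zero this, StepTree.mean]
    nlinarith

theorem all_psi_branch {ε K B b : ℝ} {G : ℝ → StepTree} (hε : 3 ≤ ε)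
    (hG : Family (2 * ε - 1) G)
    (hB : ∀ b m, 0 < b → m ≤ 5 / 3 * b → (branch ε G b).psi m ≤ B * b)
    (hBK : B ≤ K) (hK : 1 ≤ K)
    (hall : ∀ b, 0 < b → All (fun s => s.psi 0 ≤ K * s.mean) (G b)) (hb : 0 < b) :
    All (fun s => s.psi 0 ≤ K * s.mean) (branch ε G b) := by
  have hg := le_growth hε
  have hg0 : 0 < 2 - 1 / ε := by linarith
  refine ⟨?_, hall _ (by positivity), ?_⟩
  · change (branch ε G b).psi 0 ≤ K * (branch ε G b).mean
    rw [(family_branch hε hG).mean b hb]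
    exact (hB b 0 hb (by positivity)).trans (by gcongr)
  · have : 0 < b / ε := by positivity
    simp only [All, psi_leaf_zero this, StepTree.mean]
    nlinarith

theorem all_psi_chain {ε P K B a : ℝ} {G : ℝ → StepTree} (hε : 3 ≤ ε) (hP : 1 ≤ P)
    (hG : Family (2 * ε - 1) G)
    (hB : ∀ b m, 0 < b → m ≤ 5 / 3 * b → (branch ε G b).psi m ≤ B * b)
    (hBK : B ≤ K) (hPK : 4 * P ≤ K)
    (hall : ∀ b, 0 < b → All (fun s => s.psi 0 ≤ K * s.mean) (G b)) (j : ℕ) (ha : 0 < a) :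
    All (fun s => s.psi 0 ≤ K * s.mean) (chain ε P G j a) := by
  have hK : 1 ≤ K := by linarith
  have hchain : ∀ j m, m ≤ 5 / 4 * a → (chain ε P G j a).psi m ≤ K * a := by
    intro j m hm
    refine (psi_chain_le hε hP hG hB j ha hm).trans ?_
    have h1 : (0 : ℝ) ≤ (1 / 4) ^ j := by positivity
    have h2 : (1 / 4 : ℝ) ^ j ≤ 1 := pow_le_one₀ (by norm_num) (by norm_num)
    gcongr
    nlinarith
  induction j with
  | zero => exact all_psi_twoVal hP hPK ha
  | succ j ih =>
    refine ⟨?_, ⟨?_, ih, ?_⟩, ?_⟩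
    · change (chain ε P G (j + 1) a).psi 0 ≤ K * (chain ε P G (j + 1) a).mean
      rw [(family_chain hε hP hG (j + 1)).mean a ha]
      exact hchain _ _ (by positivity)
    · have hmid := (chain_mid hε hP hG j ha).2.1
      beta_reduce
      rw [hmid, psi_eq, hmid, max_eq_right (by positivity)]
      simp only [left, right]
      have h1 := hchain j (5 / 4 * a) le_rfl
      have h2 := hB (3 / 2 * a) (5 / 4 * a) (by positivity) (by linarith)
      have h3 : B * (3 / 2 * a) ≤ K * (3 / 2 * a) := by gcongr
      linarith
    · exact all_psi_branch hε hG hB hBK hK hall (by positivity)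
    · exact all_psi_branch hε hG hB hBK hK hall (by positivity)

theorem carl_node_inv (l r : StepTree) : (node l r).inv.carl =
    (node l r).inv.mean ^ 2 * (node l r).mean + (l.inv.carl + r.inv.carl) / 2 := by
  rw [show (node l r).inv = node l.inv r.inv from rfl, carl,
    show node l.inv r.inv = (node l r).inv from rfl, inv_inv]

theorem carl_twoVal_inv {P a : ℝ} (hP : 1 ≤ P) (ha : 0 < a) :
    (twoVal P a).inv.carl = (P ^ 2 + P) / a := by
  have hf := family_twoVal hP
  have h1 := hf.inv_mean a ha
  have h2 := hf.mean a ha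
  unfold twoVal at h1 h2 ⊢
  rw [carl_node_inv, h1, h2]
  simp only [inv, mean, carl] at h1 ⊢
  rw [h1]
  field_simp

theorem carl_branch_inv_le {ε κ b : ℝ} {G : ℝ → StepTree} (hε : 3 ≤ ε)
    (hG : Family (2 * ε - 1) G) (hκ : 0 ≤ κ)
    (hcarl : ∀ b, 0 < b → (G b).inv.carl ≤ κ / b) (hb : 0 < b) :
    (branch ε G b).inv.carl ≤ (ε ^ 2 + ε / 2 + 3 / 10 * κ) / b := by
  have hg := le_growth hε
  have hg0 : 0 < 2 - 1 / ε := by linarith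
  have hf := family_branch hε hG
  have h1 := hf.inv_mean b hb
  have h2 := hf.mean b hb
  have h3 := hcarl ((2 - 1 / ε) * b) (by positivity)
  have h4 : κ / ((2 - 1 / ε) * b) ≤ κ / (5 / 3 * b) := by gcongr
  unfold branch at h1 h2 ⊢
  rw [carl_node_inv, h1, h2]
  simp only [inv, carl, inv_div]
  have e : (ε ^ 2 + ε / 2 + 3 / 10 * κ) / b =
      (ε / b) ^ 2 * b + (κ / (5 / 3 * b) + ε / b) / 2 := by
    field_simp
    ring
  rw [e]
  linarith

/-- The Carleson sums of the reciprocal weight. Along the chain the terms grow geometrically, so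
they are dominated by the last one; this is the role of the negative term. -/
theorem carl_chain_inv_le {ε P K a : ℝ} {G : ℝ → StepTree} (hε : 3 ≤ ε) (hP : 1 ≤ P)
    (hKε : 24 * ε ≤ K) (hKP : 5 * P + 1 ≤ K)
    (hG : Family (2 * ε - 1) G)
    (hcarl : ∀ b, 0 < b → (G b).inv.carl ≤ K * (2 * ε - 1) / b) (j : ℕ) (ha : 0 < a) :
    (chain ε P G j a).inv.carl ≤
      (K * chainProd ε P j - 4 * chainProd ε P j ^ 2) / a := by
  induction j with
  | zero =>
    simp only [chain, chainProd]
    rw [carl_twoVal_inv hP ha]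
    gcongr
    nlinarith
  | succ j ih =>
    have hf := family_chain hε hP hG (j + 1)
    have h1 := hf.inv_mean a ha
    have h2 := hf.mean a ha
    obtain ⟨-, h3, h4⟩ := chain_mid hε hP hG j ha
    have hκ : 0 ≤ K * (2 * ε - 1) := mul_nonneg (by linarith) (by linarith)
    have h5 := carl_branch_inv_le (b := 3 / 2 * a) hε hG hκ hcarl (by positivity)
    have h6 := carl_branch_inv_le (b := 3 / 4 * a) hε hG hκ hcarl (by positivity)
    have hp := chainProd_pos (show 0 < ε by linarith) (show 0 < P by linarith) j
    unfold chain at h1 h2 ⊢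
    rw [carl_node_inv, h1, h2, carl_node_inv, h3, h4]
    simp only [chainProd]
    generalize chainProd ε P j = p at *
    refine le_trans (add_le_add_right (div_le_div_of_nonneg_right (add_le_add (add_le_add_right
      (div_le_div_of_nonneg_right (add_le_add ih h5) zero_le_two) _) h6) zero_le_two) _) ?_
    rw [le_div_iff₀ ha]
    have e : (((5 / 6 * ε + p / 4) / a) ^ 2 * a +
        (((ε / 3 + p / 2) / a) ^ 2 * (5 / 4 * a) +
          ((K * p - 4 * p ^ 2) / a + (ε ^ 2 + ε / 2 + 3 / 10 * (K * (2 * ε - 1))) / (3 / 2 * a)) / 2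
          + (ε ^ 2 + ε / 2 + 3 / 10 * (K * (2 * ε - 1))) / (3 / 4 * a)) / 2) * a =
        (5 / 6 * ε + p / 4) ^ 2 + 5 / 8 * (ε / 3 + p / 2) ^ 2 + (K * p - 4 * p ^ 2) / 4 +
          5 / 6 * (ε ^ 2 + ε / 2 + 3 / 10 * (K * (2 * ε - 1))) := by
      field_simp
      ring
    rw [e]
    nlinarith [sq_nonneg (p - 2 * ε), mul_le_mul_of_nonneg_left hKε (show 0 ≤ ε by linarith)]

theorem all_carl_twoVal_inv {P K a : ℝ} (hP : 1 ≤ P) (hK : 5 * P + 1 ≤ K) (ha : 0 < a) :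
    All (fun s => s.inv.carl ≤ K * s.inv.mean) (twoVal P a) := by
  have hf := family_twoVal hP
  have hpos := hf.pos a ha
  refine ⟨?_, ?_, ?_⟩
  · change (twoVal P a).inv.carl ≤ K * (twoVal P a).inv.mean
    rw [hf.inv_mean a ha, carl_twoVal_inv hP ha, mul_div_assoc']
    gcongr
    nlinarith
  · have : 0 < (a * (1 + √(1 - P⁻¹)))⁻¹ := inv_pos.2 hpos.1
    simp only [All, carl, inv, StepTree.mean]
    nlinarith
  · have : 0 < (a * (1 - √(1 - P⁻¹)))⁻¹ := inv_pos.2 hpos.2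
    simp only [All, carl, inv, StepTree.mean]
    nlinarith

theorem all_carl_branch_inv {ε K b : ℝ} {G : ℝ → StepTree} (hε : 3 ≤ ε)
    (hKε : 24 * ε ≤ K) (hG : Family (2 * ε - 1) G)
    (hcarl : ∀ b, 0 < b → (G b).inv.carl ≤ K * (2 * ε - 1) / b)
    (hall : ∀ b, 0 < b → All (fun s => s.inv.carl ≤ K * s.inv.mean) (G b)) (hb : 0 < b) :
    All (fun s => s.inv.carl ≤ K * s.inv.mean) (branch ε G b) := by
  have hg := le_growth hε
  have hg0 : 0 < 2 - 1 / ε := by linarith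
  have hκ : 0 ≤ K * (2 * ε - 1) := mul_nonneg (by linarith) (by linarith)
  refine ⟨?_, hall _ (by positivity), ?_⟩
  · change (branch ε G b).inv.carl ≤ K * (branch ε G b).inv.mean
    rw [(family_branch hε hG).inv_mean b hb, mul_div_assoc']
    refine (carl_branch_inv_le hε hG hκ hcarl hb).trans ?_
    gcongr
    nlinarith
  · have : 0 < (b / ε)⁻¹ := by positivity
    simp only [All, carl, inv, StepTree.mean]
    nlinarith

theorem all_carl_chain_inv {ε P K a : ℝ} {G : ℝ → StepTree} (hε : 3 ≤ ε) (hP : 1 ≤ P)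
    (hKε : 24 * ε ≤ K) (hKP : 5 * P + 1 ≤ K)
    (hG : Family (2 * ε - 1) G)
    (hcarl : ∀ b, 0 < b → (G b).inv.carl ≤ K * (2 * ε - 1) / b)
    (hall : ∀ b, 0 < b → All (fun s => s.inv.carl ≤ K * s.inv.mean) (G b)) (j : ℕ)
    (ha : 0 < a) :
    All (fun s => s.inv.carl ≤ K * s.inv.mean) (chain ε P G j a) := by
  have hκ : 0 ≤ K * (2 * ε - 1) := mul_nonneg (by linarith) (by linarith)
  induction j with
  | zero => exact all_carl_twoVal_inv hP hKP ha
  | succ j ih =>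
    refine ⟨?_, ⟨?_, ih, ?_⟩, ?_⟩
    · change (chain ε P G (j + 1) a).inv.carl ≤ K * (chain ε P G (j + 1) a).inv.mean
      rw [(family_chain hε hP hG (j + 1)).inv_mean a ha, mul_div_assoc']
      refine (carl_chain_inv_le hε hP hKε hKP hG hcarl (j + 1) ha).trans ?_
      gcongr
      nlinarith [sq_nonneg (chainProd ε P (j + 1))]
    · obtain ⟨-, h3, h4⟩ := chain_mid hε hP hG j ha
      have h5 := carl_branch_inv_le (b := 3 / 2 * a) hε hG hκ hcarl (by positivity)
      have h6 := carl_chain_inv_le hε hP hKε hKP hG hcarl j ha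
      have hp := chainProd_pos (show 0 < ε by linarith) (show 0 < P by linarith) j
      rw [carl_node_inv, h3, h4]
      generalize chainProd ε P j = p at *
      refine le_trans (add_le_add_right
        (div_le_div_of_nonneg_right (add_le_add h6 h5) zero_le_two) _) ?_
      rw [mul_div_assoc', le_div_iff₀ ha]
      have e : (((ε / 3 + p / 2) / a) ^ 2 * (5 / 4 * a) +
          ((K * p - 4 * p ^ 2) / a + (ε ^ 2 + ε / 2 + 3 / 10 * (K * (2 * ε - 1))) / (3 / 2 * a))
          / 2) * a = 5 / 4 * (ε / 3 + p / 2) ^ 2 + (K * p - 4 * p ^ 2) / 2 +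
          1 / 3 * (ε ^ 2 + ε / 2 + 3 / 10 * (K * (2 * ε - 1))) := by
        field_simp
        ring
      rw [e]
      nlinarith [sq_nonneg (p - ε), mul_le_mul_of_nonneg_left hKε (show 0 ≤ ε by linarith)]
    · exact all_carl_branch_inv hε hKε hG hcarl hall (by positivity)
    · exact all_carl_branch_inv hε hKε hG hcarl hall (by positivity)

/-- The square function of a cell is passed on to the `branch` that contains it, up to the factor
`1 - 1 / (2 ε)` that accounts for the mass of the leaf. -/
theorem le_sq_branch {ε σ b : ℝ} {G : ℝ → StepTree} (hε : 3 ≤ ε) (hG : Family (2 * ε - 1) G)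
    (hsq : ∀ b, 0 < b → σ * b ≤ (G b).sq) (hb : 0 < b) :
    (1 - 1 / (2 * ε)) * σ * b ≤ (branch ε G b).sq := by
  have hg := le_growth hε
  have hg0 : 0 < 2 - 1 / ε := by linarith
  have h1 := hsq ((2 - 1 / ε) * b) (by positivity)
  have h2 : 0 < (branch ε G b).inv.mean := by
    rw [(family_branch hε hG).inv_mean b hb]
    positivity
  rw [sq_eq]
  have h3 := mul_nonneg (sq_nonneg (((branch ε G b).right.mean - (branch ε G b).left.mean) / 2))
    h2.le
  have h4 : (branch ε G b).left.sq = (G ((2 - 1 / ε) * b)).sq := rfl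
  have h5 : (branch ε G b).right.sq = 0 := rfl
  have h6 : (1 - 1 / (2 * ε)) * σ * b = σ * ((2 - 1 / ε) * b) / 2 := by
    field_simp
  rw [h4, h5, h6]
  linarith

/-- Every second interval of the chain contributes at least the same amount to the square function:
the growth of the averages of the reciprocal compensates for the decay of the lengths. -/
theorem le_sq_chain {ε P R s a : ℝ} {G : ℝ → StepTree} (hε : 3 ≤ ε) (hP : 1 ≤ P)
    (hG : Family (2 * ε - 1) G) (hR : ∀ j, R * (1 / 4) ^ j ≤ chainProd ε P j)
    (hs : ∀ b, 0 < b → s * b ≤ (branch ε G b).sq) (j : ℕ) (ha : 0 < a) :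
    (j * R / 16 * (1 / 4) ^ j + (1 - (1 / 4) ^ j) * s) * a ≤ (chain ε P G j a).sq := by
  induction j with
  | zero => simpa using sq_nonneg_of_pos ((family_chain hε hP hG 0).pos a ha)
  | succ j ih =>
    have hB := family_branch hε hG
    have h1 := (family_chain hε hP hG (j + 1)).inv_mean a ha
    obtain ⟨h2, h3, -⟩ := chain_mid hε hP hG j ha
    have h5 := hs (3 / 2 * a) (by positivity)
    have h6 := hs (3 / 4 * a) (by positivity)
    have h7 := hR (j + 1)
    have h8 := le_sq_node h2.1 h2.2
    rw [sq_eq, h1]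
    simp only [chain, left, right]
    rw [h3, hB.mean _ (by positivity)]
    have h9 : ((3 / 4 * a - 5 / 4 * a) / 2) ^ 2 * (chainProd ε P (j + 1) / a) =
        chainProd ε P (j + 1) / 16 * a := by
      field_simp
      ring
    rw [h9]
    have h10 : R * (1 / 4) ^ (j + 1) / 16 * a ≤ chainProd ε P (j + 1) / 16 * a := by gcongr
    rw [pow_succ] at h10 ⊢
    push_cast
    linarith

/-! ### The choice of the parameters -/

theorem chainProd_eq (E : ℝ) (j : ℕ) :
    chainProd (9 / 8 * (E + 1)) (5 / 4 * (E + 1) + E ^ 2) j =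
      5 / 4 * (E + 1) + E ^ 2 * (1 / 4) ^ j := by
  induction j with
  | zero => simp [chainProd]
  | succ j ih =>
    rw [chainProd, ih, pow_succ]
    ring

/-- At the top of the chain the product of the averages is `2 ε - 1`, the one required of the cells,
so that the construction can be iterated. -/
theorem chainProd_end (T : ℕ) :
    chainProd (9 / 8 * ((4 : ℝ) ^ T + 1)) (5 / 4 * ((4 : ℝ) ^ T + 1) + ((4 : ℝ) ^ T) ^ 2) T =
      2 * (9 / 8 * ((4 : ℝ) ^ T + 1)) - 1 := by
  rw [chainProd_eq, one_div_pow]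
  field_simp
  ring

/-- The weight of average `a` built of `N` generations of cells, with chains of `2 T` steps. The
parameters are `ε = 9 (4 ^ T + 1) / 8` and `P = 5 (4 ^ T + 1) / 4 + 16 ^ T`; with these the recursion
for `chainProd` has the fixed point `5 (4 ^ T + 1) / 4` and the cells reproduce themselves
(`chainProd_end`). -/
noncomputable def climb (T N : ℕ) (a : ℝ) : StepTree :=
  tower (9 / 8 * ((4 : ℝ) ^ T + 1)) (5 / 4 * ((4 : ℝ) ^ T + 1) + ((4 : ℝ) ^ T) ^ 2) T N a

theorem climb_succ (T N : ℕ) : climb T (N + 1) =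
    chain (9 / 8 * ((4 : ℝ) ^ T + 1)) (5 / 4 * ((4 : ℝ) ^ T + 1) + ((4 : ℝ) ^ T) ^ 2) (climb T N) T :=
  rfl

theorem family_climb {T : ℕ} (hT : 1 ≤ T) (N : ℕ) :
    Family (2 * (9 / 8 * ((4 : ℝ) ^ T + 1)) - 1) (climb T N) := by
  have hE : (4 : ℝ) ≤ 4 ^ T := le_self_pow₀ (by norm_num) (by omega)
  induction N with
  | zero => exact family_twoVal (by linarith)
  | succ N ih =>
    rw [climb_succ]
    have := family_chain (P := 5 / 4 * ((4 : ℝ) ^ T + 1) + ((4 : ℝ) ^ T) ^ 2) (by linarith)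
      (by nlinarith) ih T
    rwa [chainProd_end] at this

/-- The testing condition for `climb`. The loss of the fraction `4 ^ (-T)` of the mass at the end of
each chain absorbs the cost `O(4 ^ T)` of a cell. -/
theorem psi_climb {T : ℕ} (hT : 1 ≤ T) (N : ℕ) :
    (∀ b m : ℝ, 0 < b → m ≤ 5 / 4 * b → (climb T N b).psi m ≤ 10 * ((4 : ℝ) ^ T) ^ 2 * b) ∧
    ∀ b : ℝ, 0 < b → All (fun s => s.psi 0 ≤ 20 * ((4 : ℝ) ^ T) ^ 2 * s.mean) (climb T N b) := by
  have hE : (4 : ℝ) ≤ 4 ^ T := le_self_pow₀ (by norm_num) (by omega)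
  induction N with
  | zero =>
    refine ⟨fun b m hb hm => ?_, fun b hb => all_psi_twoVal (by linarith) (by nlinarith) hb⟩
    refine (psi_twoVal_le (by linarith) hb (by linarith)).trans ?_
    exact mul_le_mul_of_nonneg_right (by nlinarith) hb.le
  | succ N ih =>
    have hf := family_climb hT N
    have hpow : ((1 : ℝ) / 4) ^ T = ((4 : ℝ) ^ T)⁻¹ := by rw [one_div, inv_pow]
    rw [climb_succ]
    set E : ℝ := (4 : ℝ) ^ T
    have hε : 3 ≤ 9 / 8 * (E + 1) := by linarith
    have hP : 1 ≤ 5 / 4 * (E + 1) + E ^ 2 := by nlinarith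
    have hρ : 1 - 1 / (2 * (9 / 8 * (E + 1))) ≤ 1 := by
      have : 0 ≤ 1 / (2 * (9 / 8 * (E + 1))) := by positivity
      linarith
    have hB : ∀ b m, 0 < b → m ≤ 5 / 3 * b → (branch (9 / 8 * (E + 1)) (climb T N) b).psi m ≤
        (10 * E ^ 2 + 2 * (9 / 8 * (E + 1))) * b := by
      intro b m hb hm
      refine (psi_branch_le hε ih.1 hf hb hm).trans ?_
      have := mul_le_of_le_one_left (show 0 ≤ 10 * E ^ 2 by positivity) hρ
      exact mul_le_mul_of_nonneg_right (by linarith) hb.le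
    refine ⟨fun b m hb hm => ?_, fun b hb => ?_⟩
    · refine (psi_chain_le hε hP hf hB T hb hm).trans ?_
      gcongr
      rw [hpow]
      have hEi : E⁻¹ * E = 1 := inv_mul_cancel₀ (by positivity)
      have hEi0 : 0 < E⁻¹ := by positivity
      have e : (1 - E⁻¹) * (10 * E ^ 2 + 2 * (9 / 8 * (E + 1))) +
          E⁻¹ * (4 * (5 / 4 * (E + 1) + E ^ 2)) =
          10 * E ^ 2 - 10 * E * (E⁻¹ * E) + 9 / 4 * (E + 1) - 9 / 4 * (E⁻¹ * E) - 9 / 4 * E⁻¹ +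
            5 * (E⁻¹ * E) + 5 * E⁻¹ + 4 * E * (E⁻¹ * E) := by ring
      rw [e, hEi]
      have : E⁻¹ ≤ 1 := inv_le_one_of_one_le₀ (by linarith)
      linarith
    · exact all_psi_chain hε hP hf hB (by nlinarith) (by nlinarith) ih.2 T hb

/-- The testing condition for the reciprocal of `climb`, in the stronger form of a bound for
Carleson sums. -/
theorem carl_climb {T : ℕ} (hT : 1 ≤ T) (N : ℕ) :
    (∀ b : ℝ, 0 < b → (climb T N b).inv.carl ≤
      20 * ((4 : ℝ) ^ T) ^ 2 * (2 * (9 / 8 * ((4 : ℝ) ^ T + 1)) - 1) / b) ∧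
    ∀ b : ℝ, 0 < b →
      All (fun s => s.inv.carl ≤ 20 * ((4 : ℝ) ^ T) ^ 2 * s.inv.mean) (climb T N b) := by
  have hE : (4 : ℝ) ≤ 4 ^ T := le_self_pow₀ (by norm_num) (by omega)
  induction N with
  | zero =>
    refine ⟨fun b hb => ?_, fun b hb => all_carl_twoVal_inv (by linarith) (by nlinarith) hb⟩
    refine (carl_twoVal_inv (by linarith) hb).le.trans ?_
    gcongr
    set E : ℝ := (4 : ℝ) ^ T
    have h1 : 0 ≤ 2 * (9 / 8 * (E + 1)) - 1 := by linarith
    have h2 : 2 * (9 / 8 * (E + 1)) - 1 + 1 ≤ 20 * E ^ 2 := by nlinarith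
    nlinarith [mul_le_mul_of_nonneg_right h2 h1]
  | succ N ih =>
    have hf := family_climb hT N
    have hend := chainProd_end T
    rw [climb_succ]
    set E : ℝ := (4 : ℝ) ^ T
    have hε : 3 ≤ 9 / 8 * (E + 1) := by linarith
    have hP : 1 ≤ 5 / 4 * (E + 1) + E ^ 2 := by nlinarith
    have hK1 : 24 * (9 / 8 * (E + 1)) ≤ 20 * E ^ 2 := by nlinarith
    have hK2 : 5 * (5 / 4 * (E + 1) + E ^ 2) + 1 ≤ 20 * E ^ 2 := by nlinarith
    refine ⟨fun b hb => ?_, fun b hb => all_carl_chain_inv hε hP hK1 hK2 hf ih.1 ih.2 T hb⟩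
    refine (carl_chain_inv_le hε hP hK1 hK2 hf ih.1 T hb).trans ?_
    rw [hend]
    gcongr
    nlinarith [sq_nonneg (2 * (9 / 8 * (E + 1)) - 1)]

/-- One generation of cells maps a lower bound `s` to `T E / 16 + (1 - 2 / E) s` with `E = 4 ^ T`; the
fixed point of this map is `T E ^ 2 / 32`. -/
theorem le_sq_climb {T : ℕ} (hT : 1 ≤ T) (N : ℕ) {b : ℝ} (hb : 0 < b) :
    T * ((4 : ℝ) ^ T) ^ 2 / 32 * (1 - (1 - 2 / (4 : ℝ) ^ T) ^ N) * b ≤ (climb T N b).sq := by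
  have hE : (4 : ℝ) ≤ 4 ^ T := le_self_pow₀ (by norm_num) (by omega)
  induction N generalizing b with
  | zero => simpa using sq_nonneg_of_pos ((family_climb hT 0).pos b hb)
  | succ N ih =>
    have hf := family_climb hT N
    have hpow : ((1 : ℝ) / 4) ^ T = ((4 : ℝ) ^ T)⁻¹ := by rw [one_div, inv_pow]
    have hprod := chainProd_eq ((4 : ℝ) ^ T)
    rw [climb_succ]
    set E : ℝ := (4 : ℝ) ^ T
    have hε : 3 ≤ 9 / 8 * (E + 1) := by linarith
    have hP : 1 ≤ 5 / 4 * (E + 1) + E ^ 2 := by nlinarith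
    have hx0 : 0 ≤ 1 - 2 / E := by
      rw [sub_nonneg, div_le_one (by positivity)]
      linarith
    have hx1 : 1 - 2 / E ≤ 1 := by
      have : 0 ≤ 2 / E := by positivity
      linarith
    set σ : ℝ := T * E ^ 2 / 32 * (1 - (1 - 2 / E) ^ N) with hσ
    have hσ0 : 0 ≤ σ := by
      have : (1 - 2 / E) ^ N ≤ 1 := pow_le_one₀ hx0 hx1
      have : 0 ≤ 1 - (1 - 2 / E) ^ N := by linarith
      positivity
    have hbr := fun b (hb : 0 < b) => le_sq_branch hε hf (fun b hb => ih (b := b) hb) hb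
    have h := le_sq_chain (R := E ^ 2) (s := (1 - 1 / (2 * (9 / 8 * (E + 1)))) * σ) hε hP hf
      (fun j => by rw [hprod]; linarith) hbr T hb
    refine le_trans ?_ h
    gcongr
    rw [hpow]
    have e1 : T * E ^ 2 / 16 * E⁻¹ = T * E / 16 := by
      field_simp
    have e2 : T * E ^ 2 / 32 * (1 - (1 - 2 / E) ^ (N + 1)) = T * E / 16 + (1 - 2 / E) * σ := by
      rw [hσ, pow_succ (1 - 2 / E) N]
      generalize (1 - 2 / E) ^ N = X
      field_simp
      ring
    have h3 : 1 / (2 * (9 / 8 * (E + 1))) ≤ E⁻¹ := by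
      rw [← one_div]
      exact one_div_le_one_div_of_le (by positivity) (by linarith)
    have h4 : 0 ≤ 1 / (2 * (9 / 8 * (E + 1))) := by positivity
    have h5 : 1 - 2 / E ≤ (1 - E⁻¹) * (1 - 1 / (2 * (9 / 8 * (E + 1)))) := by
      have : 0 ≤ E⁻¹ := by positivity
      rw [div_eq_mul_inv]
      nlinarith [mul_nonneg this h4]
    have h6 := mul_le_mul_of_nonneg_right h5 hσ0
    rw [mul_assoc (1 - E⁻¹)] at h6
    rw [e1, e2]
    linarith

theorem desc_succ_zero (t : StepTree) (n : ℕ) : t.desc (n + 1) 0 = t.left.desc n 0 := by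
  induction n with
  | zero => simp [desc]
  | succ n ih =>
    have h : ∀ (s : StepTree) m, s.desc (m + 1) 0 = (s.desc m 0).left := fun s m => by simp [desc]
    rw [h, ih, h]

theorem desc_chain (ε P : ℝ) (G : ℝ → StepTree) (j : ℕ) (a : ℝ) :
    (chain ε P G j a).desc (2 * j) 0 = twoVal P a := by
  induction j with
  | zero => rfl
  | succ j ih =>
    rw [show 2 * (j + 1) = 2 * j + 1 + 1 by ring, desc_succ_zero, desc_succ_zero]
    exact ih

theorem all_psi_inv_of_carl {t : StepTree} {K : ℝ} (ht : t.Pos)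
    (h : All (fun s => s.inv.carl ≤ K * s.inv.mean) t) :
    All (fun s => s.psi 0 ≤ K * s.mean) t.inv := by
  induction t with
  | leaf c => exact (psi_le_carl ht.inv).trans h
  | node l r hl hr =>
    exact ⟨(psi_le_carl (Pos.inv ht)).trans h.1, hl ht.1 h.2.1, hr ht.2 h.2.2⟩

/-- The testing condition for two halves with all averages equal to `a = √q`: the whole interval
contributes at most the product `q` of the averages. -/
theorem test_symm {l r : StepTree} {a q K : ℝ} (ha : 0 < a) (hq : a * a = q) (hl : l.Pos)
    (hr : r.Pos) (hlm : l.mean = a) (hrm : r.mean = a) (hli : l.inv.mean = a)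
    (hri : r.inv.mean = a)
    (hl' : All (fun s => s.psi 0 ≤ K * s.mean) l) (hr' : All (fun s => s.psi 0 ≤ K * s.mean) r) :
    All (fun s => s.psi 0 ≤ (K + q) * s.mean) (node l r) := by
  have hq0 : 0 < q := by rw [← hq]; positivity
  have key : ∀ s : StepTree, s.Pos → All (fun s => s.psi 0 ≤ K * s.mean) s →
      All (fun s => s.psi 0 ≤ (K + q) * s.mean) s := by
    intro s hs h
    induction s with
    | leaf c =>
      have hc : 0 < c := hs
      simp only [All, mean] at h ⊢
      nlinarith
    | node l r ihl ihr =>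
      have := hs.mean_pos
      refine ⟨?_, ihl hs.1 h.2.1, ihr hs.2 h.2.2⟩
      have := h.1
      nlinarith
  refine ⟨?_, key l hl hl', key r hr hr'⟩
  have h1 := psi_node_le hl hr
  have h2 := hl'.self
  have h3 := hr'.self
  simp only [inv, mean, hlm, hrm, hli, hri] at h1 h2 h3 ⊢
  nlinarith

/-- The two halves of `[0,1)` carry a weight of the construction and its reciprocal. -/
theorem exists_stepTree {T : ℕ} (hT : 1 ≤ T) : ∃ t : StepTree, t.Pos ∧
    (∀ n k, (t.desc n k).psi 0 ≤ 24 * ((4 : ℝ) ^ T) ^ 2 * (t.desc n k).mean) ∧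
    (∀ n k, (t.inv.desc n k).psi 0 ≤ 24 * ((4 : ℝ) ^ T) ^ 2 * (t.inv.desc n k).mean) ∧
    (∃ I : DyadicIndex, ((4 : ℝ) ^ T) ^ 2 ≤ (t.desc I.1 I.2).mean * (t.desc I.1 I.2).inv.mean) ∧
    T * ((4 : ℝ) ^ T) ^ 2 / 128 ≤ t.sq / t.mean ∧
    T * ((4 : ℝ) ^ T) ^ 2 / 128 ≤ t.inv.sq / t.inv.mean := by
  have hE : (4 : ℝ) ≤ 4 ^ T := le_self_pow₀ (by norm_num) (by omega)
  -- The square function estimate is within a factor `2` of its limit after `N` generations.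
  obtain ⟨N, hN⟩ : ∃ N : ℕ, (1 - 2 / (4 : ℝ) ^ T) ^ N < 1 / 2 := by
    refine exists_pow_lt_of_lt_one (by norm_num) ?_
    have : 0 < 2 / (4 : ℝ) ^ T := by positivity
    linarith
  -- With average `√q`, the weight and its reciprocal have the same average.
  set q : ℝ := 2 * (9 / 8 * ((4 : ℝ) ^ T + 1)) - 1 with hq
  have hq0 : 0 < q := by linarith
  set a : ℝ := √q with ha
  have ha0 : 0 < a := Real.sqrt_pos.2 hq0
  have haq : a * a = q := Real.mul_self_sqrt hq0.le
  set A : StepTree := climb T (N + 1) a with hA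
  have hf := family_climb hT (N + 1)
  rw [← hq] at hf
  have hAp : A.Pos := hf.pos a ha0
  have hAm : A.mean = a := hf.mean a ha0
  have hAi : A.inv.mean = a := by
    rw [hf.inv_mean a ha0, ← haq]
    field_simp
  have hsq : T * ((4 : ℝ) ^ T) ^ 2 / 64 * a ≤ A.sq := by
    refine le_trans ?_ (le_sq_climb hT (N + 1) ha0)
    gcongr
    have h0 : (0 : ℝ) ≤ T * ((4 : ℝ) ^ T) ^ 2 / 32 := by positivity
    have h1 : (1 - 2 / (4 : ℝ) ^ T) ^ (N + 1) ≤ (1 - 2 / (4 : ℝ) ^ T) ^ N := by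
      refine pow_le_pow_of_le_one ?_ ?_ (Nat.le_succ N)
      · rw [sub_nonneg, div_le_one (by positivity)]
        linarith
      · have : 0 ≤ 2 / (4 : ℝ) ^ T := by positivity
        linarith
    nlinarith
  have h1 : All (fun s => s.psi 0 ≤ 20 * ((4 : ℝ) ^ T) ^ 2 * s.mean) A :=
    (psi_climb hT (N + 1)).2 a ha0
  have h2 : All (fun s => s.psi 0 ≤ 20 * ((4 : ℝ) ^ T) ^ 2 * s.mean) A.inv :=
    all_psi_inv_of_carl hAp ((carl_climb hT (N + 1)).2 a ha0)
  have hKq : 20 * ((4 : ℝ) ^ T) ^ 2 + q ≤ 24 * ((4 : ℝ) ^ T) ^ 2 := by nlinarith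
  have hAii : A.inv.inv.mean = a := by rw [inv_inv, hAm]
  have hsqi := sq_nonneg_of_pos hAp.inv
  refine ⟨node A A.inv, ⟨hAp, hAp.inv⟩, fun n k => ?_, fun n k => ?_, ?_, ?_, ?_⟩
  · have hp := (Pos.desc (show (node A A.inv).Pos from ⟨hAp, hAp.inv⟩) n k).mean_pos
    exact ((test_symm ha0 haq hAp hAp.inv hAm hAi hAi hAii h1 h2).desc n k).trans
      (by gcongr)
  · have hp := (Pos.desc (show (node A A.inv).inv.Pos from
      Pos.inv ⟨hAp, hAp.inv⟩) n k).mean_pos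
    refine le_trans ?_ (mul_le_mul_of_nonneg_right hKq hp.le)
    have e : (node A A.inv).inv = node A.inv A := by rw [inv, inv_inv]
    rw [e]
    exact (test_symm ha0 haq hAp.inv hAp hAi hAm hAii hAi h2 h1).desc n k
  · -- The last interval of the first chain in the left half.
    refine ⟨⟨2 * T + 1, ⟨0, by positivity⟩⟩, ?_⟩
    have hd : (node A A.inv).desc (2 * T + 1) 0 =
        twoVal (5 / 4 * ((4 : ℝ) ^ T + 1) + ((4 : ℝ) ^ T) ^ 2) a := by
      rw [desc_succ_zero]
      exact desc_chain _ _ _ _ _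
    have hv := family_twoVal (show 1 ≤ 5 / 4 * ((4 : ℝ) ^ T + 1) + ((4 : ℝ) ^ T) ^ 2 by nlinarith)
    simp only [hd]
    rw [hv.mean a ha0, hv.inv_mean a ha0, mul_div_cancel₀ _ ha0.ne']
    linarith
  · have h3 := le_sq_node hAp hAp.inv
    have h4 : (node A A.inv).mean = a := by
      simp only [mean, hAm, hAi]
      ring
    rw [h4, le_div_iff₀ ha0]
    linarith
  · have h3 := le_sq_node hAp.inv hAp
    have h4 : (node A.inv A).mean = a := by
      simp only [mean, hAm, hAi]
      ring
    rw [show (node A A.inv).inv = node A.inv A by rw [inv, inv_inv], h4, le_div_iff₀ ha0]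
    linarith

end StepTree

/-! ### Conclusion -/

theorem mulSqrtLog_mono {s t : ℝ≥0∞} (h : s ≤ t) : mulSqrtLog s ≤ mulSqrtLog t :=
  mul_le_mul' h (ENNReal.rpow_le_rpow
    (EReal.toENNReal_le_toENNReal (ENNReal.log_monotone h)) (by norm_num))

theorem mulSqrtLog_ofReal {x : ℝ} (hx : 0 < x) :
    mulSqrtLog (ENNReal.ofReal x) = ENNReal.ofReal (x * √(Real.log x)) := by
  rw [mulSqrtLog, ENNReal.log_ofReal_of_pos hx, EReal.real_coe_toENNReal,
    ENNReal.ofReal_mul hx.le, Real.sqrt_eq_rpow]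
  congr 1
  rcases le_or_gt (Real.log x) 0 with h | h
  · rcases h.lt_or_eq with h' | h'
    · rw [ENNReal.ofReal_of_nonpos h, ← Real.sqrt_eq_rpow, Real.sqrt_eq_zero_of_nonpos h]
      simp
    · simp [h']
  · exact ENNReal.ofReal_rpow_of_pos h

theorem coe_one_div : ((1 / 400 : ℝ≥0) : ℝ≥0∞) = ENNReal.ofReal (1 / 400) := by
  rw [ENNReal.ofReal]
  congr 1
  ext
  rw [Real.coe_toNNReal _ (by norm_num)]
  norm_num

/-- The comparison of `‖M‖ √(log ‖M‖) ≲ 4 ^ T √T` with the lower bound for the square function. -/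
theorem mulSqrtLog_le {T : ℕ} (hT : 1 ≤ T) {M : ℝ≥0∞}
    (hM : M ≤ ENNReal.ofReal √(4 * (24 * ((4 : ℝ) ^ T) ^ 2))) :
    ((1 / 400 : ℝ≥0) : ℝ≥0∞) * mulSqrtLog M ≤
      ENNReal.ofReal √(T * ((4 : ℝ) ^ T) ^ 2 / 128) := by
  have hE : (0 : ℝ) < 4 ^ T := by positivity
  have hT1 : (1 : ℝ) ≤ T := by exact_mod_cast hT
  have h1 : √(4 * (24 * ((4 : ℝ) ^ T) ^ 2)) ≤ 10 * 4 ^ T := by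
    rw [Real.sqrt_le_left (by positivity)]
    nlinarith [sq_nonneg ((4 : ℝ) ^ T)]
  have h2 : Real.log (10 * 4 ^ T) ≤ 9 * T := by
    have h3 : Real.log (4 ^ (2 + T)) = (2 + T) * Real.log 4 := by
      rw [Real.log_pow]
      push_cast
      ring
    have h4 : Real.log 4 ≤ 3 := by
      have := Real.log_le_sub_one_of_pos (show (0 : ℝ) < 4 by norm_num)
      linarith
    have h5 : Real.log (10 * 4 ^ T) ≤ Real.log (4 ^ (2 + T)) := by
      refine Real.log_le_log (by positivity) ?_
      rw [pow_add]
      gcongr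
      norm_num
    rw [h3] at h5
    nlinarith
  have h6 : √(Real.log (10 * 4 ^ T)) ≤ 3 * √T := by
    rw [Real.sqrt_le_left (by positivity), mul_pow, Real.sq_sqrt (by positivity)]
    linarith
  have h7 : 1 / 400 * (10 * 4 ^ T * (3 * √T)) ≤ √(T * ((4 : ℝ) ^ T) ^ 2 / 128) := by
    refine Real.le_sqrt_of_sq_le ?_
    have : (1 / 400 * (10 * 4 ^ T * (3 * √(T : ℝ)))) ^ 2 =
        9 / 1600 * ((4 : ℝ) ^ T) ^ 2 * √(T : ℝ) ^ 2 := by ring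
    rw [this, Real.sq_sqrt (by positivity)]
    have : 0 ≤ T * ((4 : ℝ) ^ T) ^ 2 := by positivity
    linarith
  calc ((1 / 400 : ℝ≥0) : ℝ≥0∞) * mulSqrtLog M
      ≤ ENNReal.ofReal (1 / 400) * mulSqrtLog (ENNReal.ofReal (10 * 4 ^ T)) := by
        rw [coe_one_div]
        exact mul_le_mul_right (mulSqrtLog_mono (hM.trans (ENNReal.ofReal_le_ofReal h1))) _
    _ = ENNReal.ofReal (1 / 400 * (10 * 4 ^ T * √(Real.log (10 * 4 ^ T)))) := by
        rw [mulSqrtLog_ofReal (by positivity), ← ENNReal.ofReal_mul (by norm_num)]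
    _ ≤ _ := ENNReal.ofReal_le_ofReal (le_trans (by gcongr) h7)

end DyadicWeights

open DyadicWeights

theorem theorem4p2 :
    ∃ c C : ℝ≥0, 0 < c ∧ ∃ w : ℕ → ℝ → ℝ,
      (∀ j, DyadicWeights.IsWeight (w j) ∧ DyadicWeights.a2Char (w j) < ∞) ∧
      Tendsto (fun j => DyadicWeights.a2Char (w j)) atTop (𝓝 ∞) ∧
      ∀ j,
        -- (1)
        ((c : ℝ≥0∞) * DyadicWeights.maximalNorm (w j)⁻¹ ^ 2 ≤ DyadicWeights.a2Char (w j) ∧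
          DyadicWeights.a2Char (w j) ≤ (C : ℝ≥0∞) * DyadicWeights.maximalNorm (w j)⁻¹ ^ 2) ∧
        -- (2)
        (DyadicWeights.normL2 (DyadicWeights.squareFnW (w j))
            (DyadicWeights.weightMeasure (w j)) (DyadicWeights.weightMeasure (w j)⁻¹) =
          DyadicWeights.squareNorm (w j)⁻¹ ∧
        (c : ℝ≥0∞) * DyadicWeights.mulSqrtLog (DyadicWeights.maximalNorm (w j)⁻¹) ≤
          DyadicWeights.normL2 (DyadicWeights.squareFnW (w j))
            (DyadicWeights.weightMeasure (w j)) (DyadicWeights.weightMeasure (w j)⁻¹)) ∧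
        -- (3)
        (c : ℝ≥0∞) * DyadicWeights.mulSqrtLog (DyadicWeights.maximalNorm (w j)⁻¹) ≤
          DyadicWeights.normL21 (DyadicWeights.squareFnW (w j))
            (DyadicWeights.weightMeasure (w j)) (DyadicWeights.weightMeasure (w j)⁻¹) ∧
        -- (4)
        (c : ℝ≥0∞) * DyadicWeights.mulSqrtLog (DyadicWeights.maximalNorm (w j)) ≤
          DyadicWeights.squareNorm (w j) := by
  choose t hpos htest htesti hI hsq hsqi using
    fun j : ℕ => StepTree.exists_stepTree (T := j + 1) (Nat.le_add_left 1 j)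
  have hK : ∀ j : ℕ, (0 : ℝ) < 24 * ((4 : ℝ) ^ (j + 1)) ^ 2 := fun j => by positivity
  have hM : ∀ j, maximalNorm (t j).inv.toFun ≤ _ := fun j =>
    maximalNorm_inv_le (hpos j) (hK j) (htest j)
  have hMi : ∀ j, maximalNorm (t j).toFun ≤
      ENNReal.ofReal √(4 * (24 * ((4 : ℝ) ^ (j + 1)) ^ 2)) := fun j => by
    have := maximalNorm_inv_le (hpos j).inv (hK j) (htesti j)
    rwa [StepTree.inv_inv] at this
  have hA2 : ∀ j, ENNReal.ofReal (((4 : ℝ) ^ (j + 1)) ^ 2) ≤ a2Char (t j).toFun := by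
    intro j
    obtain ⟨I, hI⟩ := hI j
    rw [StepTree.a2Char_toFun (hpos j)]
    exact le_iSup_of_le I (ENNReal.ofReal_le_ofReal hI)
  refine ⟨1 / 400, 1, by norm_num, fun j => (t j).toFun, fun j => ⟨?_, ?_⟩, ?_, fun j => ?_⟩
  · exact StepTree.isWeight_toFun (hpos j)
  · exact (a2Char_le_maximalNorm_sq (hpos j)).trans_lt
      (ENNReal.pow_lt_top ((hM j).trans_lt ENNReal.ofReal_lt_top))
  · refine tendsto_nhds_top_mono (ENNReal.tendsto_ofReal_atTop.comp ?_)
      (Eventually.of_forall hA2)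
    exact (tendsto_pow_atTop (two_ne_zero)).comp
      ((tendsto_pow_atTop_atTop_of_one_lt (by norm_num)).comp (tendsto_add_atTop_nat 1))
  · have hS := le_norms_squareFnW (hpos j)
    have hSi := (le_norms_squareFnW (hpos j).inv).1
    have hMS := mulSqrtLog_le (Nat.le_add_left 1 j) (hM j)
    have hMSi := mulSqrtLog_le (Nat.le_add_left 1 j) (hMi j)
    have hle := hMS.trans (ENNReal.ofReal_le_ofReal (Real.sqrt_le_sqrt (hsq j)))
    have hlei := hMSi.trans (ENNReal.ofReal_le_ofReal (Real.sqrt_le_sqrt (hsqi j)))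
    have heq := normL2_squareFnW (t j).inv.measurable_toFun (StepTree.toFun_pos (hpos j).inv)
    rw [← StepTree.toFun_inv, StepTree.inv_inv] at heq
    rw [StepTree.inv_inv, heq] at hSi
    simp only [← StepTree.toFun_inv]
    refine ⟨⟨?_, ?_⟩, ⟨?_, hle.trans hS.1⟩, hle.trans hS.2, hlei.trans hSi⟩
    · refine le_trans ?_ (hA2 j)
      calc ((1 / 400 : ℝ≥0) : ℝ≥0∞) * maximalNorm (t j).inv.toFun ^ 2
          ≤ ENNReal.ofReal (1 / 400) *
              ENNReal.ofReal √(4 * (24 * ((4 : ℝ) ^ (j + 1)) ^ 2)) ^ 2 := by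
            rw [coe_one_div]
            gcongr
            exact hM j
        _ ≤ _ := by
            rw [← ENNReal.ofReal_pow (Real.sqrt_nonneg _), Real.sq_sqrt (by positivity),
              ← ENNReal.ofReal_mul (by norm_num)]
            refine ENNReal.ofReal_le_ofReal ?_
            have : 0 < ((4 : ℝ) ^ (j + 1)) ^ 2 := by positivity
            linarith
    · rw [ENNReal.coe_one, one_mul]
      exact a2Char_le_maximalNorm_sq (hpos j)
    · have := normL2_squareFnW (t j).measurable_toFun (StepTree.toFun_pos (hpos j))
      rwa [← StepTree.toFun_inv] at this
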